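/- **Setting.** All algebras are complex, associative, not necessarily unital. For a non-degenerate algebra $A$, $M(A)$ denotes its multiplier algebra (pairs of a left multiplier $a\mapsto Ta$ and a right multiplier $a\mapsto aT$ with $a(Tb)=(aT)b$). A *multiplier bialgebroid* $\mathcal A=(A,B,C,S_B,S_C,\Delta_B,\Delta_C)$ consists of a non-degenerate idempotent algebra $A$, commuting subalgebras $B,C\subseteq M(A)$, anti-isomorphisms $S_B\colon B\to C$, $S_C\colon C\to B$, and linear maps $\Delta_B$, $\Delta_C$ as follows. Let ${}_BA\otimes A^B$ be the quotient of $A\otimes A$ by the relations $xa\otimes b=a\otimes S_B(x)b$ ($x\in B$), and ${}^CA\otimes A_C$ the quotient by $aS_C(y)\otimes b=a\otimes by$ ($y\in C$). The actions of $B$ on $A$ by $a\mapsto xa$ and $a\mapsto S_B(x)a$, and those of $C$ by $a\mapsto ay$ and $a\mapsto aS_C(y)$, are faithful and idempotent; ${}_BA\otimes A^B$ is non-degenerate as a right module over $A\otimes1$ and over $1\otimes A$, and ${}^CA\otimes A_C$ is non-degenerate as a left module over $A\otimes 1$ and over $1\otimes A$. The map $\Delta_B\colon A\to\operatorname{End}({}_BA\otimes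 A^B)$ is a homomorphism, $\Delta_C\colon A\to\operatorname{End}({}^CA\otimes A_C)^{\mathrm{op}}$ is a homomorphism (with $\Delta_C(a)$ written on the right), and for all $a,b\in A$ there are elements $\Delta_B(a)(b\otimes 1)$, $\Delta_B(a)(1\otimes b)$ of ${}_BA\otimes A^B$ and $(b\otimes1)\Delta_C(a)$, $(1\otimes b)\Delta_C(a)$ of ${}^CA\otimes A_C$ with $$\Delta_B(a)(b\otimes c)=\big(\Delta_B(a)(b\otimes1)\big)(1\otimes c)=\big(\Delta_B(a)(1\otimes c)\big)(b\otimes1),$$ $$(b\otimes c)\Delta_C(a)=(1\otimes c)\big((b\otimes1)\Delta_C(a)\big)=(b\otimes1)\big((1\otimes c)\Delta_C(a)\big)$$ for all $b,c$. For $x,x'\in B$, $y,y'\in C$, one has $\Delta_B(xyax'y')=(y\otimes x)\Delta_B(a)(y'\otimes x')$ and $\Delta_C(xyax'y')=(y\otimes x)\Delta_C(a)(y'\otimes x')$. With the canonical maps $$T_\lambda(a\otimes b)=\Delta_B(b)(a\otimes1),\quad T_\rho(a\otimes b)=\Delta_B(a)(1\otimes b),\quad {}_\lambda T(a\otimes b)=(a\otimes1)\Delta_C(b),\quad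 {}_\rho T(a\otimes b)=(1\otimes b)\Delta_C(a),$$ each pair $(L,R)\in\{(T_\lambda,T_\rho),({}_\lambda T,{}_\rho T),(T_\lambda,{}_\rho T),({}_\lambda T,T_\rho)\}$ satisfies $(L\otimes\iota)(\iota\otimes R)=(\iota\otimes R)(L\otimes\iota)$ as maps from $A\otimes A\otimes A$ to the quotient of $A\otimes A\otimes A$ by the relations of the target of $L$ in the first two factors and those of the target of $R$ in the last two factors (co-associativity and mixed co-associativity). A *left counit* is a linear map $\varepsilon_B\colon A\to B$ with $\varepsilon_B(xa)=x\varepsilon_B(a)$, $\varepsilon_B(S_B(x)a)=\varepsilon_B(a)x$, and such that $c\otimes d\mapsto S_B(\varepsilon_B(c))d$ maps $T_\rho(a\otimes b)$ to $ab$ and $c\otimes d\mapsto\varepsilon_B(d)c$ maps $T_\lambda(a\otimes b)$ to $ba$. A *right counit* is a linear map $\varepsilon_C\colon A\to C$ with $\varepsilon_C(ay)=\varepsilon_C(a)y$, $\varepsilon_C(aS_C(y))=y\varepsilon_C(a)$, and such that $c\otimes d\mapsto d\varepsilon_C(c)$ maps ${}_\rho T(a\otimes b)$ to $ba$ and $c\otimes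 d\mapsto cS_C(\varepsilon_C(d))$ maps ${}_\lambda T(a\otimes b)$ to $ab$. $\mathcal A$ is a *regular multiplier Hopf algebroid* if the maps induced by $T_\lambda,T_\rho,{}_\lambda T,{}_\rho T$ on the quotients of $A\otimes A$ by the relations $S_B(x)a\otimes b=a\otimes bS_B(x)$, $ax\otimes b=a\otimes xb$, $ay\otimes b=a\otimes yb$, $S_C(y)a\otimes b=a\otimes bS_C(y)$, respectively, are bijective, and $S_B({}_BI)A=I^BA=A\,S_C(I_C)=A\cdot{}^CI=A$, where ${}_BI,I^B\subseteq B$ and $I_C,{}^CI\subseteq C$ are the spans of the values of all linear maps $\omega\colon A\to B$ with $\omega(xa)=x\omega(a)$, respectively $\omega(S_B(x)a)=\omega(a)x$, and of all linear maps $\omega\colon A\to C$ with $\omega(ay)=\omega(a)y$, respectively $\omega(aS_C(y))=y\omega(a)$. An *(invertible) antipode* of $\mathcal A$ is a linear anti-automorphism $S$ of $A$ with $S(xyax'y')=S_C(y')S_B(x')S(a)S_C(y)S_B(x)$ such that, for some left counit $\varepsilon_B$ and right counit $\varepsilon_C$, the map $c\otimes d\mapsto S(c)d$ sends $T_\rho(a\otimes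 b)$ to $S_C(\varepsilon_C(a))b$, and $c\otimes d\mapsto cS(d)$ sends ${}_\lambda T(a\otimes b)$ to $aS_B(\varepsilon_B(b))$. The *bi-opposite* is $\mathcal A^{\mathrm{op},\mathrm{co}}=(A^{\mathrm{op}},C^{\mathrm{op}},B^{\mathrm{op}},S_C,S_B,(\Delta_C)^{\mathrm{op},\mathrm{co}},(\Delta_B)^{\mathrm{op},\mathrm{co}})$, where, with $J\colon A\to A^{\mathrm{op}}$ the canonical anti-isomorphism, $(\Delta_C)^{\mathrm{op},\mathrm{co}}(J(a))$ and $(\Delta_B)^{\mathrm{op},\mathrm{co}}(J(a))$ are obtained from $\Delta_C(a)$ and $\Delta_B(a)$ by conjugation with $b\otimes c\mapsto J(c)\otimes J(b)$. An *isomorphism* $\mathcal A\to\mathcal A'$ of multiplier bialgebroids is an algebra isomorphism $F\colon A\to A'$ whose extension to multipliers maps $B$ onto $B'$ and $C$ onto $C'$ and intertwines $S_B$ with $S_{B'}$ and $S_C$ with $S_{C'}$, and which satisfies $(F\otimes F)\circ\Delta_B(a)=\Delta_{B'}(F(a))\circ(F\otimes F)$ and $(F\otimes F)(w\,\Delta_C(a))=\big((F\otimes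 F)(w)\big)\Delta_{C'}(F(a))$ for all $a\in A$ and $w\in{}^CA\otimes A_C$. **Corollary.** Let $\mathcal A=(A,B,C,S_B,S_C,\Delta_B,\Delta_C)$ be a regular multiplier Hopf algebroid with antipode $S$. Then $\mathcal A^{\mathrm{op},\mathrm{co}}$ is a multiplier bialgebroid and $S$, regarded as the map $A\to A^{\mathrm{op}}$, $a\mapsto J(S(a))$, is an isomorphism of multiplier bialgebroids from $\mathcal A$ onto $\mathcal A^{\mathrm{op},\mathrm{co}}$. Moreover, every left counit $\varepsilon_B$ and every right counit $\varepsilon_C$ of $\mathcal A$ satisfy $$S_B\circ\varepsilon_B=\varepsilon_C\circ S\qquad\text{and}\qquad S_C\circ\varepsilon_C=\varepsilon_B\circ S .$$ -/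

import Mathlib

open scoped TensorProduct

noncomputable section

/-! ## Multipliers of a non-unital complex algebra -/

section Multipliers

variable (A : Type*) [NonUnitalRing A] [Module ℂ A] [IsScalarTower ℂ A A] [SMulCommClass ℂ A A]

/-- The multiplier algebra of `A`: pairs `(L, R)` consisting of a left multiplier `L : a ↦ T a`
and a right multiplier `R : a ↦ a T` that are related by `a (T b) = (a T) b`. If `A` is
non-degenerate, each of the two components determines the other one, and the first projection
identifies this algebra with `{T ∈ L(A) | A T ⊆ A}`. -/
def multiplierAlgebra : Subalgebra ℂ (Module.End ℂ A × (Module.End ℂ A)ᵐᵒᵖ) where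
  carrier := {T | (∀ a b, T.1 (a * b) = T.1 a * b) ∧
    (∀ a b, T.2.unop (a * b) = a * T.2.unop b) ∧
    (∀ a b, a * T.1 b = T.2.unop a * b)}
  mul_mem' := by
    rintro T U ⟨h1, h2, h3⟩ ⟨k1, k2, k3⟩
    refine ⟨fun a b => ?_, fun a b => ?_, fun a b => ?_⟩
    · simp [h1, k1]
    · simp [h2, k2]
    · simp [h3, k3]
  add_mem' := by
    rintro T U ⟨h1, h2, h3⟩ ⟨k1, k2, k3⟩
    refine ⟨fun a b => ?_, fun a b => ?_, fun a b => ?_⟩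
    · simp [h1, k1, add_mul]
    · simp [h2, k2, mul_add]
    · simp [h3, k3, add_mul, mul_add]
  algebraMap_mem' := by
    intro r
    refine ⟨fun a b => ?_, fun a b => ?_, fun a b => ?_⟩
    · simp [Algebra.algebraMap_eq_smul_one, smul_mul_assoc]
    · simp [Algebra.algebraMap_eq_smul_one, mul_smul_comm]
    · simp [Algebra.algebraMap_eq_smul_one, smul_mul_assoc, mul_smul_comm]

/-- The type of multipliers of `A`. -/
def Multiplier : Type _ := ↥(multiplierAlgebra A)

instance : Ring (Multiplier A) := inferInstanceAs (Ring ↥(multiplierAlgebra A))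

instance : Algebra ℂ (Multiplier A) := inferInstanceAs (Algebra ℂ ↥(multiplierAlgebra A))

variable {A}

namespace Multiplier

/-- Left multiplication `a ↦ T a` by a multiplier. -/
def lm (T : Multiplier A) : A →ₗ[ℂ] A := T.1.1

/-- Right multiplication `a ↦ a T` by a multiplier. -/
def rm (T : Multiplier A) : A →ₗ[ℂ] A := T.1.2.unop

theorem lm_mul_right (T : Multiplier A) (a b : A) : T.lm (a * b) = T.lm a * b := T.2.1 a b

theorem rm_mul_left (T : Multiplier A) (a b : A) : T.rm (a * b) = a * T.rm b := T.2.2.1 a b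

theorem mul_lm (T : Multiplier A) (a b : A) : a * T.lm b = T.rm a * b := T.2.2.2 a b

theorem lm_mul (T U : Multiplier A) (a : A) : (T * U).lm a = T.lm (U.lm a) := rfl

theorem rm_mul (T U : Multiplier A) (a : A) : (T * U).rm a = U.rm (T.rm a) := rfl

/-- The linear map `T ↦ (a ↦ T a)`. -/
def lmHom : Multiplier A →ₗ[ℂ] A →ₗ[ℂ] A where
  toFun := lm
  map_add' _ _ := rfl
  map_smul' _ _ := rfl

/-- The linear map `T ↦ (a ↦ a T)`. -/
def rmHom : Multiplier A →ₗ[ℂ] A →ₗ[ℂ] A where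
  toFun := rm
  map_add' _ _ := rfl
  map_smul' _ _ := rfl

theorem ext_lm_rm {T U : Multiplier A} (h : T.lm = U.lm) (k : T.rm = U.rm) : T = U :=
  Subtype.ext (Prod.ext h (MulOpposite.unop_injective k))

/-- The multiplier with the given left and right multiplication. -/
def ofMaps (L R : A →ₗ[ℂ] A) (h1 : ∀ a b, L (a * b) = L a * b)
    (h2 : ∀ a b, R (a * b) = a * R b) (h3 : ∀ a b, a * L b = R a * b) : Multiplier A :=
  ⟨(L, MulOpposite.op R), h1, h2, h3⟩

variable {A' : Type*} [NonUnitalRing A'] [Module ℂ A'] [IsScalarTower ℂ A' A']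
  [SMulCommClass ℂ A' A']

/-- The extension of an algebra isomorphism `F : A → A'` to the multiplier algebras,
determined by `F(T) F(a) = F(T a)` and `F(a) F(T) = F(a T)`. -/
def congr (F : A ≃ₗ[ℂ] A') (hF : ∀ a b, F (a * b) = F a * F b) (T : Multiplier A) :
    Multiplier A' :=
  ofMaps (F.toLinearMap ∘ₗ T.lm ∘ₗ F.symm.toLinearMap)
    (F.toLinearMap ∘ₗ T.rm ∘ₗ F.symm.toLinearMap)
    (by
      have hs : ∀ a b, F.symm (a * b) = F.symm a * F.symm b := fun a b =>
        F.injective (by simp [hF])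
      intro a b; simp [hs, lm_mul_right, hF])
    (by
      have hs : ∀ a b, F.symm (a * b) = F.symm a * F.symm b := fun a b =>
        F.injective (by simp [hF])
      intro a b; simp [hs, rm_mul_left, hF])
    (by
      intro a b
      have h := congrArg F (mul_lm T (F.symm a) (F.symm b))
      simpa [hF] using h)

theorem congr_lm (F : A ≃ₗ[ℂ] A') (hF : ∀ a b, F (a * b) = F a * F b) (T : Multiplier A)
    (a : A) : (congr F hF T).lm (F a) = F (T.lm a) := by
  change F (T.lm (F.symm (F a))) = _
  simp

theorem congr_rm (F : A ≃ₗ[ℂ] A') (hF : ∀ a b, F (a * b) = F a * F b) (T : Multiplier A)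
    (a : A) : (congr F hF T).rm (F a) = F (T.rm a) := by
  change F (T.rm (F.symm (F a))) = _
  simp

/-- The identification `M(A)ᵒᵖ ≅ M(Aᵒᵖ)`: a multiplier of `A`, regarded as a multiplier of the
opposite algebra, with left and right multiplication interchanged. -/
def toOp : Multiplier A ≃ₗ[ℂ] Multiplier Aᵐᵒᵖ where
  toFun T := ofMaps
    ((MulOpposite.opLinearEquiv ℂ).toLinearMap ∘ₗ T.rm ∘ₗ
      (MulOpposite.opLinearEquiv ℂ).symm.toLinearMap)
    ((MulOpposite.opLinearEquiv ℂ).toLinearMap ∘ₗ T.lm ∘ₗ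
      (MulOpposite.opLinearEquiv ℂ).symm.toLinearMap)
    (fun a b => MulOpposite.unop_injective (by simp [rm_mul_left]))
    (fun a b => MulOpposite.unop_injective (by simp [lm_mul_right]))
    (fun a b => MulOpposite.unop_injective (by simp [mul_lm]))
  invFun T := ofMaps
    ((MulOpposite.opLinearEquiv ℂ).symm.toLinearMap ∘ₗ T.rm ∘ₗ
      (MulOpposite.opLinearEquiv ℂ).toLinearMap)
    ((MulOpposite.opLinearEquiv ℂ).symm.toLinearMap ∘ₗ T.lm ∘ₗ
      (MulOpposite.opLinearEquiv ℂ).toLinearMap)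
    (fun a b => MulOpposite.op_injective (by simp [rm_mul_left]))
    (fun a b => MulOpposite.op_injective (by simp [lm_mul_right]))
    (fun a b => MulOpposite.op_injective (by simp [mul_lm]))
  left_inv _ := rfl
  right_inv _ := rfl
  map_add' _ _ := rfl
  map_smul' _ _ := rfl

theorem toOp_lm (T : Multiplier A) (a : Aᵐᵒᵖ) :
    (toOp T).lm a = MulOpposite.op (T.rm a.unop) := rfl

theorem toOp_rm (T : Multiplier A) (a : Aᵐᵒᵖ) :
    (toOp T).rm a = MulOpposite.op (T.lm a.unop) := rfl

theorem toOp_mul (T U : Multiplier A) : toOp (T * U) = toOp U * toOp T := rfl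

theorem toOp_symm_mul (T U : Multiplier Aᵐᵒᵖ) :
    toOp.symm (T * U) = toOp.symm U * toOp.symm T := rfl

/-- For a subalgebra `B ⊆ M(A)`, the subalgebra `Bᵒᵖ ⊆ M(Aᵒᵖ)`, which is the image of `B`. -/
def opSubalgebra (B : NonUnitalSubalgebra ℂ (Multiplier A)) :
    NonUnitalSubalgebra ℂ (Multiplier Aᵐᵒᵖ) where
  carrier := {T | toOp.symm T ∈ B}
  zero_mem' := by simp
  add_mem' := fun {T U} hT hU => by
    have := B.add_mem hT hU
    simpa using this
  mul_mem' := fun {T U} hT hU => by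
    have := B.mul_mem hU hT
    simpa [toOp_symm_mul] using this
  smul_mem' := fun c T hT => by
    have := B.toSubmodule.smul_mem c hT
    change toOp.symm (c • T) ∈ B
    simpa using this

/-- The canonical linear (and anti-multiplicative) bijection `Bᵒᵖ → B`. -/
def opSubalgebraEquiv (B : NonUnitalSubalgebra ℂ (Multiplier A)) : opSubalgebra B ≃ₗ[ℂ] B where
  toFun T := ⟨toOp.symm T.1, T.2⟩
  invFun T := ⟨toOp T.1, by
    change toOp.symm (toOp T.1) ∈ B
    simp⟩
  left_inv _ := rfl
  right_inv _ := rfl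
  map_add' _ _ := rfl
  map_smul' _ _ := rfl

end Multiplier

end Multipliers

/-! ## Balanced tensor products -/

section Balanced

variable {X V : Type*} [AddCommGroup V] [Module ℂ V]

/-- The subspace of `V ⊗ V` spanned by the elements `f x v ⊗ w - v ⊗ g x w`. The quotient by it is
the balanced tensor product of the two module structures on `V` given by `f` and `g`. -/
def balancedRel (f g : X → V →ₗ[ℂ] V) : Submodule ℂ (V ⊗[ℂ] V) :=
  Submodule.span ℂ {t | ∃ x v w, t = f x v ⊗ₜ[ℂ] w - v ⊗ₜ[ℂ] g x w}

theorem balancedRel_le {W : Type*} [AddCommGroup W] [Module ℂ W] {f g : X → V →ₗ[ℂ] V}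
    (h : V ⊗[ℂ] V →ₗ[ℂ] W) (N : Submodule ℂ W)
    (hh : ∀ x v w, h (f x v ⊗ₜ[ℂ] w) - h (v ⊗ₜ[ℂ] g x w) ∈ N) :
    balancedRel f g ≤ N.comap h := by
  refine Submodule.span_le.2 ?_
  rintro _ ⟨x, v, w, rfl⟩
  simpa using hh x v w

theorem balancedRel_mem {f g : X → V →ₗ[ℂ] V} (x : X) (v w : V) :
    f x v ⊗ₜ[ℂ] w - v ⊗ₜ[ℂ] g x w ∈ balancedRel f g :=
  Submodule.subset_span ⟨x, v, w, rfl⟩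

/-- The map `u ⊗ v` on a balanced tensor product, for module maps `u` and `v`. -/
def balancedMap {f g : X → V →ₗ[ℂ] V} (u v : V →ₗ[ℂ] V)
    (hu : ∀ x a, u (f x a) = f x (u a)) (hv : ∀ x a, v (g x a) = g x (v a)) :
    ((V ⊗[ℂ] V) ⧸ balancedRel f g) →ₗ[ℂ] ((V ⊗[ℂ] V) ⧸ balancedRel f g) :=
  Submodule.mapQ _ _ (TensorProduct.map u v) (balancedRel_le _ _ fun x a b => by
    simpa [hu, hv] using balancedRel_mem x (u a) (v b))

variable (p₁ p₂ : Submodule ℂ (V ⊗[ℂ] V))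

/-- The relations defining an iterated tensor product of three copies of `V` in which the first two
factors are balanced by `p₁` and the last two factors are balanced by `p₂`. -/
def tripleRel : Submodule ℂ (V ⊗[ℂ] (V ⊗[ℂ] V)) :=
  (LinearMap.range (LinearMap.rTensor V p₁.subtype)).map
      (TensorProduct.assoc ℂ V V V).toLinearMap ⊔
    LinearMap.range (LinearMap.lTensor V p₂.subtype)

/-- The canonical map from `(V ⊗ V)/p₁ ⊗ V` onto the iterated tensor product. -/
def tripleOfLeft :
    ((V ⊗[ℂ] V) ⧸ p₁) ⊗[ℂ] V →ₗ[ℂ] (V ⊗[ℂ] (V ⊗[ℂ] V)) ⧸ tripleRel p₁ p₂ :=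
  TensorProduct.lift (p₁.liftQ
    (TensorProduct.curry ((tripleRel p₁ p₂).mkQ ∘ₗ (TensorProduct.assoc ℂ V V V).toLinearMap))
    (by
      intro t ht
      rw [LinearMap.mem_ker]
      ext c
      simp only [TensorProduct.curry_apply, LinearMap.comp_apply, LinearMap.zero_apply,
        Submodule.mkQ_apply, Submodule.Quotient.mk_eq_zero]
      refine Submodule.mem_sup_left (Submodule.mem_map_of_mem ?_)
      exact ⟨(⟨t, ht⟩ : p₁) ⊗ₜ[ℂ] c, by simp⟩))

/-- The canonical map from `V ⊗ (V ⊗ V)/p₂` onto the iterated tensor product. -/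
def tripleOfRight :
    V ⊗[ℂ] ((V ⊗[ℂ] V) ⧸ p₂) →ₗ[ℂ] (V ⊗[ℂ] (V ⊗[ℂ] V)) ⧸ tripleRel p₁ p₂ :=
  TensorProduct.lift (p₂.liftQ
    (TensorProduct.curry (tripleRel p₁ p₂).mkQ).flip
    (by
      intro t ht
      rw [LinearMap.mem_ker]
      ext c
      simp only [TensorProduct.curry_apply, LinearMap.flip_apply, LinearMap.zero_apply,
        Submodule.mkQ_apply, Submodule.Quotient.mk_eq_zero]
      refine Submodule.mem_sup_right ?_
      exact ⟨c ⊗ₜ[ℂ] (⟨t, ht⟩ : p₂), by simp⟩)).flip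

/-- Commutativity of the square
`(L ⊗ ι) ∘ (ι ⊗ R) = (ι ⊗ R) ∘ (L ⊗ ι) : V ⊗ V ⊗ V → (V ⊗ V ⊗ V)/(p₁ ⊗ V + V ⊗ p₂)`
for maps `L : V ⊗ V → (V ⊗ V)/p₁` and `R : V ⊗ V → (V ⊗ V)/p₂`. The second map on each side is
evaluated on an arbitrary representative in `V ⊗ V` of the class produced by the first map. -/
def LegsCommute (L : V ⊗[ℂ] V →ₗ[ℂ] (V ⊗[ℂ] V) ⧸ p₁) (R : V ⊗[ℂ] V →ₗ[ℂ] (V ⊗[ℂ] V) ⧸ p₂) :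
    Prop :=
  ∀ (a b c : V) (r l : V ⊗[ℂ] V), p₂.mkQ r = R (b ⊗ₜ[ℂ] c) → p₁.mkQ l = L (a ⊗ₜ[ℂ] b) →
    tripleOfLeft p₁ p₂ (LinearMap.rTensor V (TensorProduct.curry L a) r) =
      tripleOfRight p₁ p₂ (LinearMap.lTensor V ((TensorProduct.curry R).flip c) l)

/-- A family of elements that is determined by a non-degenerate action depends linearly on its
parameters. -/
theorem exists_leg {V W : Type*} [AddCommGroup V] [Module ℂ V] [AddCommGroup W] [Module ℂ W]
    (act : V → W →ₗ[ℂ] W)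
    (nd : ∀ w, (∀ c, act c w = 0) → w = 0) (F : V → V →ₗ[ℂ] V →ₗ[ℂ] W)
    (h : ∀ a b, ∃ u, ∀ c, F c a b = act c u) :
    ∃ T : V ⊗[ℂ] V →ₗ[ℂ] W, ∀ a b c, F c a b = act c (T (a ⊗ₜ[ℂ] b)) := by
  choose u hu using h
  have inj : ∀ v w, (∀ c, act c v = act c w) → v = w := fun v w hvw =>
    sub_eq_zero.1 (nd _ fun c => by rw [map_sub, hvw, sub_self])
  refine ⟨TensorProduct.lift (LinearMap.mk₂ ℂ u (fun a a' b => inj _ _ fun c => ?_)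
    (fun r a b => inj _ _ fun c => ?_) (fun a b b' => inj _ _ fun c => ?_)
    (fun r a b => inj _ _ fun c => ?_)), fun a b c => by simpa using hu a b c⟩ <;>
  simp only [map_add, map_smul, ← hu, LinearMap.add_apply, LinearMap.smul_apply]

/-- The map `f` on `V ⊗ V` descends to a bijection on the quotient by `p`. -/
def DescendsToBijection {W : Type*} [AddCommGroup W] [Module ℂ W] (p : Submodule ℂ (V ⊗[ℂ] V))
    (f : V ⊗[ℂ] V →ₗ[ℂ] W) : Prop :=
  ∃ h : p ≤ LinearMap.ker f, Function.Bijective (p.liftQ f h)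

end Balanced

/-! ## Multiplier bialgebroids -/

section Bialgebroids

/-- The base of a multiplier bialgebroid: commuting subalgebras `B, C ⊆ M(A)` with
anti-isomorphisms `S_B : B → C` and `S_C : C → B`. -/
structure BaseData (A : Type*) [NonUnitalRing A] [Module ℂ A] [IsScalarTower ℂ A A]
    [SMulCommClass ℂ A A] where
  B : NonUnitalSubalgebra ℂ (Multiplier A)
  C : NonUnitalSubalgebra ℂ (Multiplier A)
  SB : B ≃ₗ[ℂ] C
  SC : C ≃ₗ[ℂ] B
  SB_mul : ∀ x x', SB (x * x') = SB x' * SB x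
  SC_mul : ∀ y y', SC (y * y') = SC y' * SC y
  comm : ∀ (x : B) (y : C), (x : Multiplier A) * (y : Multiplier A) = y * x

variable {A : Type*} [NonUnitalRing A] [Module ℂ A] [IsScalarTower ℂ A A] [SMulCommClass ℂ A A]

open Multiplier

namespace BaseData

variable (D : BaseData A)

/-- The relations `x a ⊗ b = a ⊗ S_B(x) b`, for `x ∈ B`. -/
def relL : Submodule ℂ (A ⊗[ℂ] A) :=
  balancedRel (fun x : D.B => lm x.1) (fun x : D.B => lm (D.SB x).1)

/-- The relations `a S_C(y) ⊗ b = a ⊗ b y`, for `y ∈ C`. -/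
def relR : Submodule ℂ (A ⊗[ℂ] A) :=
  balancedRel (fun y : D.C => rm (D.SC y).1) (fun y : D.C => rm y.1)

/-- The tensor product `_B A ⊗ A^B`. -/
abbrev LT : Type _ := (A ⊗[ℂ] A) ⧸ D.relL

/-- The tensor product `^C A ⊗ A_C`. -/
abbrev RT : Type _ := (A ⊗[ℂ] A) ⧸ D.relR

theorem lm_comm (x : D.B) (y : D.C) (a : A) : lm x.1 (lm y.1 a) = lm y.1 (lm x.1 a) :=
  congrArg (fun T : Multiplier A => T.lm a) (D.comm x y)

theorem rm_comm (x : D.B) (y : D.C) (a : A) : rm x.1 (rm y.1 a) = rm y.1 (rm x.1 a) :=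
  (congrArg (fun T : Multiplier A => T.rm a) (D.comm x y)).symm

/-- The map `w ↦ w (c ⊗ 1)` on `_B A ⊗ A^B`. -/
def mulFst (c : A) : D.LT →ₗ[ℂ] D.LT :=
  balancedMap (LinearMap.mulRight ℂ c) LinearMap.id
    (fun x a => by simp [lm_mul_right]) (fun x a => rfl)

/-- The map `w ↦ w (1 ⊗ c)` on `_B A ⊗ A^B`. -/
def mulSnd (c : A) : D.LT →ₗ[ℂ] D.LT :=
  balancedMap LinearMap.id (LinearMap.mulRight ℂ c)
    (fun x a => rfl) (fun x a => by simp [lm_mul_right])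

/-- The map `w ↦ (y ⊗ x) w` on `_B A ⊗ A^B`, for `y ∈ C` and `x ∈ B`. -/
def baseMul (y : D.C) (x : D.B) : D.LT →ₗ[ℂ] D.LT :=
  balancedMap (lm y.1) (lm x.1)
    (fun x' a => (D.lm_comm x' y a).symm) (fun x' a => D.lm_comm x (D.SB x') a)

/-- The map `w ↦ (c ⊗ 1) w` on `^C A ⊗ A_C`. -/
def fstMul (c : A) : D.RT →ₗ[ℂ] D.RT :=
  balancedMap (LinearMap.mulLeft ℂ c) LinearMap.id
    (fun x a => by simp [rm_mul_left]) (fun x a => rfl)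

/-- The map `w ↦ (1 ⊗ c) w` on `^C A ⊗ A_C`. -/
def sndMul (c : A) : D.RT →ₗ[ℂ] D.RT :=
  balancedMap LinearMap.id (LinearMap.mulLeft ℂ c)
    (fun x a => rfl) (fun x a => by simp [rm_mul_left])

/-- The map `w ↦ w (y ⊗ x)` on `^C A ⊗ A_C`, for `y ∈ C` and `x ∈ B`. -/
def mulBase (y : D.C) (x : D.B) : D.RT →ₗ[ℂ] D.RT :=
  balancedMap (rm y.1) (rm x.1)
    (fun y' a => (D.rm_comm (D.SC y') y a).symm) (fun y' a => D.rm_comm x y' a)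

/-- The left multiplier version of the Takeuchi product: all `T ∈ End(_B A ⊗ A^B)` such that for
every `a ∈ A` there are elements `T(a ⊗ 1)` and `T(1 ⊗ a)` with
`T(a ⊗ b) = (T(a ⊗ 1))(1 ⊗ b)` and `T(b ⊗ a) = (T(1 ⊗ a))(b ⊗ 1)` for all `b ∈ A`. -/
def leftTakeuchi : Set (Module.End ℂ D.LT) :=
  {T | ∀ a : A,
    (∃ u : D.LT, ∀ b : A, T (D.relL.mkQ (a ⊗ₜ[ℂ] b)) = D.mulSnd b u) ∧
    (∃ v : D.LT, ∀ b : A, T (D.relL.mkQ (b ⊗ₜ[ℂ] a)) = D.mulFst b v)}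

/-- The right multiplier version of the Takeuchi product: all endomorphisms `T` of `^C A ⊗ A_C`,
written on the right, such that for every `a ∈ A` there are elements `(a ⊗ 1)T` and `(1 ⊗ a)T` with
`(a ⊗ b)T = (1 ⊗ b)((a ⊗ 1)T)` and `(b ⊗ a)T = (b ⊗ 1)((1 ⊗ a)T)` for all `b ∈ A`. -/
def rightTakeuchi : Set (Module.End ℂ D.RT) :=
  {T | ∀ a : A,
    (∃ u : D.RT, ∀ b : A, T (D.relR.mkQ (a ⊗ₜ[ℂ] b)) = D.sndMul b u) ∧
    (∃ v : D.RT, ∀ b : A, T (D.relR.mkQ (b ⊗ₜ[ℂ] a)) = D.fstMul b v)}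

/-- The action map `(x, a) ↦ x a` for a subalgebra `B ⊆ M(A)`. -/
def actL (B : NonUnitalSubalgebra ℂ (Multiplier A)) : B →ₗ[ℂ] A →ₗ[ℂ] A :=
  lmHom ∘ₗ B.toSubmodule.subtype

/-- The action map `(x, a) ↦ a x` for a subalgebra `B ⊆ M(A)`. -/
def actR (B : NonUnitalSubalgebra ℂ (Multiplier A)) : B →ₗ[ℂ] A →ₗ[ℂ] A :=
  rmHom ∘ₗ B.toSubmodule.subtype

theorem actL_apply (B : NonUnitalSubalgebra ℂ (Multiplier A)) (x : B) (a : A) :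
    actL B x a = lm x.1 a := rfl

theorem actR_apply (B : NonUnitalSubalgebra ℂ (Multiplier A)) (x : B) (a : A) :
    actR B x a = rm x.1 a := rfl

/-- The slice map `φ ⊗ ι : _B A ⊗ A^B → A`, `a ⊗ b ↦ S_B(φ(a)) b`, for `φ ∈ Hom(_B A, _B B)`. -/
def leftSliceFst (φ : A →ₗ[ℂ] D.B) (hφ : ∀ (x : D.B) (a : A), φ (lm x.1 a) = x * φ a) :
    D.LT →ₗ[ℂ] A :=
  D.relL.liftQ (TensorProduct.lift (actL D.C ∘ₗ D.SB.toLinearMap ∘ₗ φ))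
    (balancedRel_le _ ⊥ fun x a b => by
      refine (Submodule.mem_bot ℂ).2 (sub_eq_zero.2 ?_)
      change lm (D.SB (φ (lm x.1 a))).1 b = lm (D.SB (φ a)).1 (lm (D.SB x).1 b)
      rw [hφ, D.SB_mul]
      rfl)

/-- The slice map `ι ⊗ ψ : _B A ⊗ A^B → A`, `a ⊗ b ↦ ψ(b) a`, for `ψ ∈ Hom(A^B, B_B)`. -/
def leftSliceSnd (ψ : A →ₗ[ℂ] D.B) (hψ : ∀ (x : D.B) (a : A), ψ (lm (D.SB x).1 a) = ψ a * x) :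
    D.LT →ₗ[ℂ] A :=
  D.relL.liftQ (TensorProduct.lift (actL D.B ∘ₗ ψ).flip)
    (balancedRel_le _ ⊥ fun x a b => by
      refine (Submodule.mem_bot ℂ).2 (sub_eq_zero.2 ?_)
      change lm (ψ b).1 (lm x.1 a) = lm (ψ (lm (D.SB x).1 b)).1 a
      rw [hψ]
      rfl)

/-- The slice map `φ ⊗ ι : ^C A ⊗ A_C → A`, `a ⊗ b ↦ b φ(a)`, for `φ ∈ Hom(^C A, _C C)`. -/
def rightSliceFst (φ : A →ₗ[ℂ] D.C) (hφ : ∀ (y : D.C) (a : A), φ (rm (D.SC y).1 a) = y * φ a) :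
    D.RT →ₗ[ℂ] A :=
  D.relR.liftQ (TensorProduct.lift (actR D.C ∘ₗ φ))
    (balancedRel_le _ ⊥ fun y a b => by
      refine (Submodule.mem_bot ℂ).2 (sub_eq_zero.2 ?_)
      change rm (φ (rm (D.SC y).1 a)).1 b = rm (φ a).1 (rm y.1 b)
      rw [hφ]
      rfl)

/-- The slice map `ι ⊗ ψ : ^C A ⊗ A_C → A`, `a ⊗ b ↦ a S_C(ψ(b))`, for `ψ ∈ Hom(A_C, C_C)`. -/
def rightSliceSnd (ψ : A →ₗ[ℂ] D.C) (hψ : ∀ (y : D.C) (a : A), ψ (rm y.1 a) = ψ a * y) :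
    D.RT →ₗ[ℂ] A :=
  D.relR.liftQ (TensorProduct.lift (actR D.B ∘ₗ D.SC.toLinearMap ∘ₗ ψ).flip)
    (balancedRel_le _ ⊥ fun y a b => by
      refine (Submodule.mem_bot ℂ).2 (sub_eq_zero.2 ?_)
      change rm (D.SC (ψ b)).1 (rm (D.SC y).1 a) = rm (D.SC (ψ (rm y.1 b))).1 a
      rw [hψ, D.SC_mul]
      rfl)

/-- The base of the bi-opposite: `(Aᵒᵖ, Cᵒᵖ, Bᵒᵖ, S_C, S_B)`. -/
def biopposite : BaseData Aᵐᵒᵖ where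
  B := opSubalgebra D.C
  C := opSubalgebra D.B
  SB := opSubalgebraEquiv D.C ≪≫ₗ D.SC ≪≫ₗ (opSubalgebraEquiv D.B).symm
  SC := opSubalgebraEquiv D.B ≪≫ₗ D.SB ≪≫ₗ (opSubalgebraEquiv D.C).symm
  SB_mul y y' := congrArg (opSubalgebraEquiv D.B).symm
    (D.SC_mul (opSubalgebraEquiv D.C y') (opSubalgebraEquiv D.C y))
  SC_mul x x' := congrArg (opSubalgebraEquiv D.C).symm
    (D.SB_mul (opSubalgebraEquiv D.B x') (opSubalgebraEquiv D.B x))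
  comm y x := congrArg toOp (D.comm (opSubalgebraEquiv D.B x) (opSubalgebraEquiv D.C y))

/-- The map `J(a) ⊗ J(b) ↦ b ⊗ a` from `Aᵒᵖ ⊗ Aᵒᵖ` to `A ⊗ A`, the composition of the flip with
the canonical anti-isomorphism in each factor. -/
def unopFlip : (Aᵐᵒᵖ ⊗[ℂ] Aᵐᵒᵖ) ≃ₗ[ℂ] A ⊗[ℂ] A :=
  TensorProduct.congr (MulOpposite.opLinearEquiv ℂ).symm (MulOpposite.opLinearEquiv ℂ).symm ≪≫ₗ
    TensorProduct.comm ℂ A A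

theorem map_unopFlip_relL : D.biopposite.relL.map (unopFlip (A := A)).toLinearMap = D.relR := by
  refine le_antisymm (Submodule.map_le_iff_le_comap.2 (balancedRel_le _ _ ?_)) ?_
  · intro y a b
    have h := D.relR.neg_mem
      (balancedRel_mem (f := fun y : D.C => rm (D.SC y).1) (g := fun y : D.C => rm y.1)
        (opSubalgebraEquiv D.C y) b.unop a.unop)
    rw [neg_sub] at h
    exact h
  · refine Submodule.span_le.2 ?_
    rintro _ ⟨y, a, b, rfl⟩
    refine ⟨MulOpposite.op b ⊗ₜ[ℂ] lm (D.biopposite.SB ((opSubalgebraEquiv D.C).symm y)).1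
        (MulOpposite.op a) -
      lm ((opSubalgebraEquiv D.C).symm y).1 (MulOpposite.op b) ⊗ₜ[ℂ] MulOpposite.op a, ?_, ?_⟩
    · have h := D.biopposite.relL.neg_mem (balancedRel_mem
        (f := fun x : D.biopposite.B => lm x.1) (g := fun x : D.biopposite.B =>
          lm (D.biopposite.SB x).1) ((opSubalgebraEquiv D.C).symm y)
        (MulOpposite.op b) (MulOpposite.op a))
      rw [neg_sub] at h
      exact h
    · exact map_sub _ _ _

theorem map_unopFlip_relR : D.biopposite.relR.map (unopFlip (A := A)).toLinearMap = D.relL := by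
  refine le_antisymm (Submodule.map_le_iff_le_comap.2 (balancedRel_le _ _ ?_)) ?_
  · intro x a b
    have h := D.relL.neg_mem
      (balancedRel_mem (f := fun x : D.B => lm x.1) (g := fun x : D.B => lm (D.SB x).1)
        (opSubalgebraEquiv D.B x) b.unop a.unop)
    rw [neg_sub] at h
    exact h
  · refine Submodule.span_le.2 ?_
    rintro _ ⟨x, a, b, rfl⟩
    refine ⟨MulOpposite.op b ⊗ₜ[ℂ] rm ((opSubalgebraEquiv D.B).symm x).1 (MulOpposite.op a) -
      rm (D.biopposite.SC ((opSubalgebraEquiv D.B).symm x)).1 (MulOpposite.op b) ⊗ₜ[ℂ]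
        MulOpposite.op a, ?_, ?_⟩
    · have h := D.biopposite.relR.neg_mem (balancedRel_mem
        (f := fun y : D.biopposite.C => rm (D.biopposite.SC y).1)
        (g := fun y : D.biopposite.C => rm y.1) ((opSubalgebraEquiv D.B).symm x)
        (MulOpposite.op b) (MulOpposite.op a))
      rw [neg_sub] at h
      exact h
    · exact map_sub _ _ _

/-- The isomorphism `J(a) ⊗ J(b) ↦ b ⊗ a` from the left tensor product of the bi-opposite
onto `^C A ⊗ A_C`. -/
def bioppositeLT : D.biopposite.LT ≃ₗ[ℂ] D.RT :=
  Submodule.Quotient.equiv _ _ unopFlip D.map_unopFlip_relL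

/-- The isomorphism `J(a) ⊗ J(b) ↦ b ⊗ a` from the right tensor product of the bi-opposite
onto `_B A ⊗ A^B`. -/
def bioppositeRT : D.biopposite.RT ≃ₗ[ℂ] D.LT :=
  Submodule.Quotient.equiv _ _ unopFlip D.map_unopFlip_relR

end BaseData

/-- The data `(A, B, C, S_B, S_C, Δ_B, Δ_C)` of a multiplier bialgebroid. The endomorphism
`ΔC a` of `^C A ⊗ A_C` is the map `w ↦ w Δ_C(a)`, that is, `Δ_C(a)` acts from the right. -/
structure MultiplierBialgebroidData (A : Type*) [NonUnitalRing A] [Module ℂ A]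
    [IsScalarTower ℂ A A] [SMulCommClass ℂ A A] extends BaseData A where
  ΔB : A →ₗ[ℂ] Module.End ℂ toBaseData.LT
  ΔC : A →ₗ[ℂ] Module.End ℂ toBaseData.RT

namespace MultiplierBialgebroidData

variable (D : MultiplierBialgebroidData A)

/-- `T(a ⊗ b) = Δ_B(b)(a ⊗ 1)`. -/
def IsTl (T : A ⊗[ℂ] A →ₗ[ℂ] D.LT) : Prop :=
  ∀ a b c, D.ΔB b (D.relL.mkQ (a ⊗ₜ[ℂ] c)) = D.mulSnd c (T (a ⊗ₜ[ℂ] b))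

/-- `T(a ⊗ b) = Δ_B(a)(1 ⊗ b)`. -/
def IsTr (T : A ⊗[ℂ] A →ₗ[ℂ] D.LT) : Prop :=
  ∀ a b c, D.ΔB a (D.relL.mkQ (c ⊗ₜ[ℂ] b)) = D.mulFst c (T (a ⊗ₜ[ℂ] b))

/-- `T(a ⊗ b) = (a ⊗ 1)Δ_C(b)`. -/
def IslT (T : A ⊗[ℂ] A →ₗ[ℂ] D.RT) : Prop :=
  ∀ a b c, D.ΔC b (D.relR.mkQ (a ⊗ₜ[ℂ] c)) = D.sndMul c (T (a ⊗ₜ[ℂ] b))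

/-- `T(a ⊗ b) = (1 ⊗ b)Δ_C(a)`. -/
def IsrT (T : A ⊗[ℂ] A →ₗ[ℂ] D.RT) : Prop :=
  ∀ a b c, D.ΔC a (D.relR.mkQ (c ⊗ₜ[ℂ] b)) = D.fstMul c (T (a ⊗ₜ[ℂ] b))

open Classical in
/-- The canonical map `T_λ : A ⊗ A → _B A ⊗ A^B`, `a ⊗ b ↦ Δ_B(b)(a ⊗ 1)`. It exists and is unique
for every left multiplier bialgebroid; otherwise the value is `0` by convention. -/
def Tl : A ⊗[ℂ] A →ₗ[ℂ] D.LT := if h : ∃ T, D.IsTl T then h.choose else 0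

open Classical in
/-- The canonical map `T_ρ : A ⊗ A → _B A ⊗ A^B`, `a ⊗ b ↦ Δ_B(a)(1 ⊗ b)`. -/
def Tr : A ⊗[ℂ] A →ₗ[ℂ] D.LT := if h : ∃ T, D.IsTr T then h.choose else 0

open Classical in
/-- The canonical map `_λT : A ⊗ A → ^C A ⊗ A_C`, `a ⊗ b ↦ (a ⊗ 1)Δ_C(b)`. -/
def lT : A ⊗[ℂ] A →ₗ[ℂ] D.RT := if h : ∃ T, D.IslT T then h.choose else 0

open Classical in
/-- The canonical map `_ρT : A ⊗ A → ^C A ⊗ A_C`, `a ⊗ b ↦ (1 ⊗ b)Δ_C(a)`. -/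
def rT : A ⊗[ℂ] A →ₗ[ℂ] D.RT := if h : ∃ T, D.IsrT T then h.choose else 0

/-- `(A, B, ι_B, S_B, Δ_B)` is a left multiplier bialgebroid. (That `B` and `S_B(B) = C` commute is
part of the base data.) -/
structure IsLeftMultiplierBialgebroid : Prop where
  nondegenerate : ∀ a : A, (∀ b, a * b = 0) → a = 0
  idempotent : Submodule.span ℂ {c : A | ∃ a b, c = a * b} = ⊤
  faithful_left : ∀ x : D.B, (∀ a, lm x.1 a = 0) → x = 0
  faithful_right : ∀ x : D.B, (∀ a, lm (D.SB x).1 a = 0) → x = 0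
  idempotent_left : Submodule.span ℂ {c : A | ∃ (x : D.B) (a : A), c = lm x.1 a} = ⊤
  idempotent_right : Submodule.span ℂ {c : A | ∃ (x : D.B) (a : A), c = lm (D.SB x).1 a} = ⊤
  nondegenerate_fst : ∀ w : D.LT, (∀ c, D.mulFst c w = 0) → w = 0
  nondegenerate_snd : ∀ w : D.LT, (∀ c, D.mulSnd c w = 0) → w = 0
  mem_takeuchi : ∀ a, D.ΔB a ∈ D.leftTakeuchi
  map_mul : ∀ a b, D.ΔB (a * b) = D.ΔB a ∘ₗ D.ΔB b
  map_base : ∀ (x x' : D.B) (y y' : D.C) (a : A),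
    D.ΔB (lm x.1 (lm y.1 (rm y'.1 (rm x'.1 a)))) =
      D.baseMul y x ∘ₗ D.ΔB a ∘ₗ D.baseMul y' x'
  coassoc : LegsCommute D.relL D.relL D.Tl D.Tr

/-- `(A, C, ι_C, S_C, Δ_C)` is a right multiplier bialgebroid. -/
structure IsRightMultiplierBialgebroid : Prop where
  nondegenerate : ∀ a : A, (∀ b, b * a = 0) → a = 0
  idempotent : Submodule.span ℂ {c : A | ∃ a b, c = a * b} = ⊤
  faithful_right : ∀ y : D.C, (∀ a, rm y.1 a = 0) → y = 0
  faithful_left : ∀ y : D.C, (∀ a, rm (D.SC y).1 a = 0) → y = 0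
  idempotent_right : Submodule.span ℂ {c : A | ∃ (y : D.C) (a : A), c = rm y.1 a} = ⊤
  idempotent_left : Submodule.span ℂ {c : A | ∃ (y : D.C) (a : A), c = rm (D.SC y).1 a} = ⊤
  nondegenerate_fst : ∀ w : D.RT, (∀ c, D.fstMul c w = 0) → w = 0
  nondegenerate_snd : ∀ w : D.RT, (∀ c, D.sndMul c w = 0) → w = 0
  mem_takeuchi : ∀ a, D.ΔC a ∈ D.rightTakeuchi
  map_mul : ∀ a b, D.ΔC (a * b) = D.ΔC b ∘ₗ D.ΔC a
  map_base : ∀ (x x' : D.B) (y y' : D.C) (a : A),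
    D.ΔC (lm x.1 (lm y.1 (rm y'.1 (rm x'.1 a)))) =
      D.mulBase y' x' ∘ₗ D.ΔC a ∘ₗ D.mulBase y x
  coassoc : LegsCommute D.relR D.relR D.lT D.rT

/-- The data form a multiplier bialgebroid. The last two conditions are mixed co-associativity. -/
structure IsMultiplierBialgebroid : Prop where
  left : D.IsLeftMultiplierBialgebroid
  right : D.IsRightMultiplierBialgebroid
  mixed_left : LegsCommute D.relL D.relR D.Tl D.rT
  mixed_right : LegsCommute D.relR D.relL D.lT D.Tr

variable {D}

theorem IsLeftMultiplierBialgebroid.isTl_Tl (h : D.IsLeftMultiplierBialgebroid) :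
    D.IsTl D.Tl := by
  have hex : ∃ T, D.IsTl T := exists_leg D.mulSnd h.nondegenerate_snd
    (fun c => LinearMap.mk₂ ℂ (fun a b => D.ΔB b (D.relL.mkQ (a ⊗ₜ[ℂ] c)))
      (by intros; rw [TensorProduct.add_tmul, map_add, map_add])
      (by intros; rw [← TensorProduct.smul_tmul', map_smul, map_smul])
      (by intros; rw [map_add]; rfl) (by intros; rw [map_smul]; rfl))
    (fun a b => (h.mem_takeuchi b a).1)
  rw [Tl, dif_pos hex]
  exact hex.choose_spec

theorem IsLeftMultiplierBialgebroid.isTr_Tr (h : D.IsLeftMultiplierBialgebroid) :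
    D.IsTr D.Tr := by
  have hex : ∃ T, D.IsTr T := exists_leg D.mulFst h.nondegenerate_fst
    (fun c => LinearMap.mk₂ ℂ (fun a b => D.ΔB a (D.relL.mkQ (c ⊗ₜ[ℂ] b)))
      (by intros; rw [map_add]; rfl) (by intros; rw [map_smul]; rfl)
      (by intros; rw [TensorProduct.tmul_add, map_add, map_add])
      (by intros; rw [TensorProduct.tmul_smul, map_smul, map_smul]))
    (fun a b => (h.mem_takeuchi a b).2)
  rw [Tr, dif_pos hex]
  exact hex.choose_spec

theorem IsRightMultiplierBialgebroid.islT_lT (h : D.IsRightMultiplierBialgebroid) :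
    D.IslT D.lT := by
  have hex : ∃ T, D.IslT T := exists_leg D.sndMul h.nondegenerate_snd
    (fun c => LinearMap.mk₂ ℂ (fun a b => D.ΔC b (D.relR.mkQ (a ⊗ₜ[ℂ] c)))
      (by intros; rw [TensorProduct.add_tmul, map_add, map_add])
      (by intros; rw [← TensorProduct.smul_tmul', map_smul, map_smul])
      (by intros; rw [map_add]; rfl) (by intros; rw [map_smul]; rfl))
    (fun a b => (h.mem_takeuchi b a).1)
  rw [lT, dif_pos hex]
  exact hex.choose_spec

theorem IsRightMultiplierBialgebroid.isrT_rT (h : D.IsRightMultiplierBialgebroid) :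
    D.IsrT D.rT := by
  have hex : ∃ T, D.IsrT T := exists_leg D.fstMul h.nondegenerate_fst
    (fun c => LinearMap.mk₂ ℂ (fun a b => D.ΔC a (D.relR.mkQ (c ⊗ₜ[ℂ] b)))
      (by intros; rw [map_add]; rfl) (by intros; rw [map_smul]; rfl)
      (by intros; rw [TensorProduct.tmul_add, map_add, map_add])
      (by intros; rw [TensorProduct.tmul_smul, map_smul, map_smul]))
    (fun a b => (h.mem_takeuchi a b).2)
  rw [rT, dif_pos hex]
  exact hex.choose_spec

variable (D)

/-! ## Counits, regular multiplier Hopf algebroids and antipodes -/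

/-- Left counits: `ε(x a) = x ε(a)`, `ε(S_B(x) a) = ε(a) x`, `(ε ⊗ ι)(Δ_B(a)(1 ⊗ b)) = a b` and
`(ι ⊗ ε)(Δ_B(b)(a ⊗ 1)) = b a`. -/
structure IsLeftCounit (ε : A →ₗ[ℂ] D.B) : Prop where
  map_left : ∀ (x : D.B) (a : A), ε (lm x.1 a) = x * ε a
  map_right : ∀ (x : D.B) (a : A), ε (lm (D.SB x).1 a) = ε a * x
  slice_fst : ∀ a b, D.leftSliceFst ε map_left (D.Tr (a ⊗ₜ[ℂ] b)) = a * b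
  slice_snd : ∀ a b, D.leftSliceSnd ε map_right (D.Tl (a ⊗ₜ[ℂ] b)) = b * a

/-- Right counits: `ε(a y) = ε(a) y`, `ε(a S_C(y)) = y ε(a)`, `(ε ⊗ ι)((1 ⊗ b)Δ_C(a)) = b a` and
`(ι ⊗ ε)((a ⊗ 1)Δ_C(b)) = a b`. -/
structure IsRightCounit (ε : A →ₗ[ℂ] D.C) : Prop where
  map_right : ∀ (y : D.C) (a : A), ε (rm y.1 a) = ε a * y
  map_left : ∀ (y : D.C) (a : A), ε (rm (D.SC y).1 a) = y * ε a
  slice_fst : ∀ a b, D.rightSliceFst ε map_left (D.rT (a ⊗ₜ[ℂ] b)) = b * a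
  slice_snd : ∀ a b, D.rightSliceSnd ε map_right (D.lT (a ⊗ₜ[ℂ] b)) = a * b

/-- The span of all `ω(a)` with `ω ∈ Hom(_B A, _B B)` and `a ∈ A`. -/
def idealLeftB : Submodule ℂ D.B :=
  Submodule.span ℂ {z | ∃ (ω : A →ₗ[ℂ] D.B) (a : A),
    (∀ (x : D.B) (b : A), ω (lm x.1 b) = x * ω b) ∧ z = ω a}

/-- The span of all `ω(a)` with `ω ∈ Hom(A^B, B_B)` and `a ∈ A`. -/
def idealRightB : Submodule ℂ D.B :=
  Submodule.span ℂ {z | ∃ (ω : A →ₗ[ℂ] D.B) (a : A),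
    (∀ (x : D.B) (b : A), ω (lm (D.SB x).1 b) = ω b * x) ∧ z = ω a}

/-- The span of all `ω(a)` with `ω ∈ Hom(A_C, C_C)` and `a ∈ A`. -/
def idealRightC : Submodule ℂ D.C :=
  Submodule.span ℂ {z | ∃ (ω : A →ₗ[ℂ] D.C) (a : A),
    (∀ (y : D.C) (b : A), ω (rm y.1 b) = ω b * y) ∧ z = ω a}

/-- The span of all `ω(a)` with `ω ∈ Hom(^C A, _C C)` and `a ∈ A`. -/
def idealLeftC : Submodule ℂ D.C :=
  Submodule.span ℂ {z | ∃ (ω : A →ₗ[ℂ] D.C) (a : A),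
    (∀ (y : D.C) (b : A), ω (rm (D.SC y).1 b) = y * ω b) ∧ z = ω a}

/-- The data form a regular multiplier Hopf algebroid: a multiplier bialgebroid whose four canonical
maps are bijective as maps
`T_λ : A^B ⊗ ^B A → _B A ⊗ A^B`, `T_ρ : A_B ⊗ _B A → _B A ⊗ A^B`,
`_λT : A_C ⊗ _C A → ^C A ⊗ A_C`, `_ρT : A^C ⊗ ^C A → ^C A ⊗ A_C`,
and for which the products of `A` with the four subspaces above are all of `A`. -/
structure IsRegularMultiplierHopfAlgebroid : Prop where
  isMultiplierBialgebroid : D.IsMultiplierBialgebroid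
  ideal_left_B :
    Submodule.span ℂ {c : A | ∃ x ∈ D.idealLeftB, ∃ a : A, c = lm (D.SB x).1 a} = ⊤
  ideal_right_B : Submodule.span ℂ {c : A | ∃ x ∈ D.idealRightB, ∃ a : A, c = lm x.1 a} = ⊤
  ideal_right_C :
    Submodule.span ℂ {c : A | ∃ y ∈ D.idealRightC, ∃ a : A, c = rm (D.SC y).1 a} = ⊤
  ideal_left_C : Submodule.span ℂ {c : A | ∃ y ∈ D.idealLeftC, ∃ a : A, c = rm y.1 a} = ⊤
  bijective_Tl : DescendsToBijection
    (balancedRel (fun x : D.B => lm (D.SB x).1) (fun x : D.B => rm (D.SB x).1)) D.Tl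
  bijective_Tr : DescendsToBijection
    (balancedRel (fun x : D.B => rm x.1) (fun x : D.B => lm x.1)) D.Tr
  bijective_lT : DescendsToBijection
    (balancedRel (fun y : D.C => rm y.1) (fun y : D.C => lm y.1)) D.lT
  bijective_rT : DescendsToBijection
    (balancedRel (fun y : D.C => lm (D.SC y).1) (fun y : D.C => rm (D.SC y).1)) D.rT

/-- Invertible antipodes: anti-automorphisms `S` of `A` with
`S(x y a x' y') = S_C(y') S_B(x') S(a) S_C(y) S_B(x)` for which there are a left counit `ε_B` and a
right counit `ε_C` with `m(S ⊗ ι)(Δ_B(a)(1 ⊗ b)) = S_C(ε_C(a)) b` and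
`m(ι ⊗ S)((a ⊗ 1)Δ_C(b)) = a S_B(ε_B(b))`, where `m(S ⊗ ι) : _B A ⊗ A^B → A` and
`m(ι ⊗ S) : ^C A ⊗ A_C → A` are the maps induced by `a ⊗ b ↦ S(a) b` and `a ⊗ b ↦ a S(b)`. -/
structure IsInvertibleAntipode (S : A ≃ₗ[ℂ] A) : Prop where
  map_mul : ∀ a b, S (a * b) = S b * S a
  map_base : ∀ (x x' : D.B) (y y' : D.C) (a : A),
    S (lm x.1 (lm y.1 (rm y'.1 (rm x'.1 a)))) =
      lm (D.SC y').1 (lm (D.SB x').1 (rm (D.SB x).1 (rm (D.SC y).1 (S a))))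
  exists_counits : ∃ (εB : A →ₗ[ℂ] D.B) (εC : A →ₗ[ℂ] D.C),
    D.IsLeftCounit εB ∧ D.IsRightCounit εC ∧
    (∃ h : D.relL ≤ LinearMap.ker
        (LinearMap.mul' ℂ A ∘ₗ TensorProduct.map S.toLinearMap LinearMap.id),
      ∀ a b, D.relL.liftQ _ h (D.Tr (a ⊗ₜ[ℂ] b)) = lm (D.SC (εC a)).1 b) ∧
    (∃ h : D.relR ≤ LinearMap.ker
        (LinearMap.mul' ℂ A ∘ₗ TensorProduct.map LinearMap.id S.toLinearMap),
      ∀ a b, D.relR.liftQ _ h (D.lT (a ⊗ₜ[ℂ] b)) = rm (D.SB (εB b)).1 a)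

/-- The bi-opposite `(Aᵒᵖ, Cᵒᵖ, Bᵒᵖ, S_C, S_B, (Δ_C)^{op,co}, (Δ_B)^{op,co})`, where the
comultiplications are those of `A`, transported along `J(a) ⊗ J(b) ↦ b ⊗ a`. -/
def biopposite : MultiplierBialgebroidData Aᵐᵒᵖ where
  toBaseData := D.toBaseData.biopposite
  ΔB := D.toBaseData.bioppositeLT.symm.conj.toLinearMap ∘ₗ D.ΔC ∘ₗ
    (MulOpposite.opLinearEquiv ℂ).symm.toLinearMap
  ΔC := D.toBaseData.bioppositeRT.symm.conj.toLinearMap ∘ₗ D.ΔB ∘ₗ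
    (MulOpposite.opLinearEquiv ℂ).symm.toLinearMap

end MultiplierBialgebroidData

/-! ## Isomorphisms -/

/-- Isomorphisms between the bases of two multiplier bialgebroids: an algebra isomorphism
`F : A → A'` whose extension to multipliers maps `B` onto `B'` and `C` onto `C'` and intertwines
`S_B` with `S_B'` and `S_C` with `S_C'`. -/
structure BaseIso {A A' : Type*} [NonUnitalRing A] [Module ℂ A] [IsScalarTower ℂ A A]
    [SMulCommClass ℂ A A] [NonUnitalRing A'] [Module ℂ A'] [IsScalarTower ℂ A' A']
    [SMulCommClass ℂ A' A'] (D : BaseData A) (D' : BaseData A') where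
  toLinearEquiv : A ≃ₗ[ℂ] A'
  map_mul : ∀ a b, toLinearEquiv (a * b) = toLinearEquiv a * toLinearEquiv b
  map_B : Multiplier.congr toLinearEquiv map_mul '' (D.B : Set (Multiplier A)) = D'.B
  map_C : Multiplier.congr toLinearEquiv map_mul '' (D.C : Set (Multiplier A)) = D'.C
  map_SB : ∀ x : D.B, Multiplier.congr toLinearEquiv map_mul (D.SB x) =
    D'.SB ⟨Multiplier.congr toLinearEquiv map_mul x, map_B.subset (Set.mem_image_of_mem _ x.2)⟩
  map_SC : ∀ y : D.C, Multiplier.congr toLinearEquiv map_mul (D.SC y) =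
    D'.SC ⟨Multiplier.congr toLinearEquiv map_mul y, map_C.subset (Set.mem_image_of_mem _ y.2)⟩

namespace BaseIso

variable {A' : Type*} [NonUnitalRing A'] [Module ℂ A'] [IsScalarTower ℂ A' A']
  [SMulCommClass ℂ A' A'] {D : BaseData A} {D' : BaseData A'} (F : BaseIso D D')

/-- The map `F ⊗ F : _B A ⊗ A^B → _{B'} A' ⊗ A'^{B'}`. -/
def mapLT : D.LT →ₗ[ℂ] D'.LT :=
  Submodule.mapQ _ _ (TensorProduct.map F.toLinearEquiv.toLinearMap F.toLinearEquiv.toLinearMap)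
    (balancedRel_le _ _ fun x a b => by
      have h := balancedRel_mem (f := fun x : D'.B => lm x.1) (g := fun x : D'.B => lm (D'.SB x).1)
        ⟨Multiplier.congr F.toLinearEquiv F.map_mul x,
          F.map_B.subset (Set.mem_image_of_mem _ x.2)⟩ (F.toLinearEquiv a) (F.toLinearEquiv b)
      simp only [← F.map_SB, congr_lm] at h
      exact h)

/-- The map `F ⊗ F : ^C A ⊗ A_C → ^{C'} A' ⊗ A'_{C'}`. -/
def mapRT : D.RT →ₗ[ℂ] D'.RT :=
  Submodule.mapQ _ _ (TensorProduct.map F.toLinearEquiv.toLinearMap F.toLinearEquiv.toLinearMap)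
    (balancedRel_le _ _ fun y a b => by
      have h := balancedRel_mem (f := fun y : D'.C => rm (D'.SC y).1) (g := fun y : D'.C => rm y.1)
        ⟨Multiplier.congr F.toLinearEquiv F.map_mul y,
          F.map_C.subset (Set.mem_image_of_mem _ y.2)⟩ (F.toLinearEquiv a) (F.toLinearEquiv b)
      simp only [← F.map_SC, congr_rm] at h
      exact h)

end BaseIso

/-- Isomorphisms of multiplier bialgebroids: isomorphisms `F` of the bases such that
`(F ⊗ F)(Δ_B(a) w) = Δ_B'(F(a)) (F ⊗ F)(w)` and `(F ⊗ F)(w Δ_C(a)) = (F ⊗ F)(w) Δ_C'(F(a))`. -/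
structure MultiplierBialgebroidIso {A A' : Type*} [NonUnitalRing A] [Module ℂ A]
    [IsScalarTower ℂ A A] [SMulCommClass ℂ A A] [NonUnitalRing A'] [Module ℂ A']
    [IsScalarTower ℂ A' A'] [SMulCommClass ℂ A' A'] (D : MultiplierBialgebroidData A)
    (D' : MultiplierBialgebroidData A') extends BaseIso D.toBaseData D'.toBaseData where
  map_ΔB : ∀ (a : A) (w : D.LT),
    toBaseIso.mapLT (D.ΔB a w) = D'.ΔB (toLinearEquiv a) (toBaseIso.mapLT w)
  map_ΔC : ∀ (a : A) (w : D.RT),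
    toBaseIso.mapRT (D.ΔC a w) = D'.ΔC (toLinearEquiv a) (toBaseIso.mapRT w)

end Bialgebroids

end

/-! The bi-opposite reverses products and tensor factors at once. Under `J(a) ⊗ J(b) ↦ b ⊗ a` its
left axioms become the right axioms of the original and conversely: `T_λ` corresponds to `_ρT`,
`T_ρ` to `_λT`, and co-associativity squares are read backwards.

The substance is that `S` reverses comultiplication: with `σ(a ⊗ b) = S(b) ⊗ S(a)`, one needs `σ(w
Δ_C(a)) = Δ_B(S(a)) σ(w)` (`twistR_ΔC`) and its mirror image (`twistL_ΔB`). For Hopf algebras this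
is uniqueness of convolution inverses. Here that argument is carried by the map `g(a ⊗ b) = T_ρ(a ⊗
S(b))` (`galois`). It is injective because `T_ρ` is bijective, it turns left multiplication by `p ⊗
1` into `Δ_B(p)`, and mixed co-associativity with the antipode axiom gives `g(_ρT(a ⊗ b)) = a ⊗
S(b)` (`galois_rT`). Hence an element killed by every `Δ_B(p)` is zero (`eq_zero_of_ΔB`).

It therefore suffices to compare `Δ_B(p) σ((u ⊗ v)Δ_C(a))` with `Δ_B(p S(a)) σ(u ⊗ v)`. Both are
linear in `p ⊗ a`; they agree on representatives of values of `_λT` by co-associativity of `Δ_C`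
(`ΔB_twistR_of_lT`), hence everywhere since `_λT` is surjective. The mirror identity follows by
applying `g` and using `_λT (S ⊗ ι) T_λ = S ⊗ ι` (`lT_map_eq`).

A left counit is determined by its first slice identity, `T_ρ` being surjective, and `S` carries the
second slice identity of a right counit into that one; the same holds with left and right exchanged.
This yields both counit formulas for arbitrary counits. -/

/-! ### Co-associativity squares: evaluation and reversal. -/

/-- Evaluation of a co-associativity square under a linear map on the triple tensor product. -/
theorem LegsCommute.apply {V W : Type*} [AddCommGroup V] [Module ℂ V] [AddCommGroup W] [Module ℂ W]
    {p₁ p₂ : Submodule ℂ (V ⊗[ℂ] V)} {L : V ⊗[ℂ] V →ₗ[ℂ] (V ⊗[ℂ] V) ⧸ p₁}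
    {R : V ⊗[ℂ] V →ₗ[ℂ] (V ⊗[ℂ] V) ⧸ p₂} (h : LegsCommute p₁ p₂ L R)
    (G : ((V ⊗[ℂ] V) ⧸ p₁) →ₗ[ℂ] V →ₗ[ℂ] W) (H : V →ₗ[ℂ] ((V ⊗[ℂ] V) ⧸ p₂) →ₗ[ℂ] W)
    (hGH : ∀ a b c, G (p₁.mkQ (a ⊗ₜ[ℂ] b)) c = H a (p₂.mkQ (b ⊗ₜ[ℂ] c)))
    {a b c : V} {r l : V ⊗[ℂ] V} (hr : p₂.mkQ r = R (b ⊗ₜ[ℂ] c)) (hl : p₁.mkQ l = L (a ⊗ₜ[ℂ] b))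
    {F K : V ⊗[ℂ] V →ₗ[ℂ] W} (hF : ∀ x y, F (x ⊗ₜ[ℂ] y) = G (L (a ⊗ₜ[ℂ] x)) y)
    (hK : ∀ x y, K (x ⊗ₜ[ℂ] y) = H x (R (y ⊗ₜ[ℂ] c))) :
    F r = K l := by
  -- The functional is built from `H`, and `hGH` identifies it with the one built from `G`. The `G`
  -- form kills the relations in the first two factors, the `H` form those in the last two, so it
  -- descends to the triple quotient.
  let f : V ⊗[ℂ] (V ⊗[ℂ] V) →ₗ[ℂ] W := TensorProduct.lift (H.compl₂ p₂.mkQ)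
  have hf : f ∘ₗ (TensorProduct.assoc ℂ V V V).toLinearMap =
      TensorProduct.lift (G ∘ₗ p₁.mkQ) := by
    apply TensorProduct.ext_threefold
    intro a b c
    simpa [f] using (hGH a b c).symm
  have hk : tripleRel p₁ p₂ ≤ LinearMap.ker f := by
    refine sup_le ?_ ?_
    · rintro _ ⟨_, ⟨t, rfl⟩, rfl⟩
      change f ((TensorProduct.assoc ℂ V V V).toLinearMap _) = 0
      rw [← LinearMap.comp_apply, hf]
      induction t with
      | zero => simp
      | add x y hx hy => rw [map_add, map_add, hx, hy, add_zero]
      | tmul x y =>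
        have : p₁.mkQ x.1 = 0 := (Submodule.Quotient.mk_eq_zero _).2 x.2
        simp only [LinearMap.rTensor_tmul, TensorProduct.lift.tmul, LinearMap.comp_apply,
          Submodule.subtype_apply, this, map_zero, LinearMap.zero_apply]
    · rintro _ ⟨t, rfl⟩
      change f _ = 0
      induction t with
      | zero => simp
      | add x y hx hy => rw [map_add, map_add, hx, hy, add_zero]
      | tmul x y =>
        have : p₂.mkQ y.1 = 0 := (Submodule.Quotient.mk_eq_zero _).2 y.2
        simp only [f, LinearMap.lTensor_tmul, TensorProduct.lift.tmul, LinearMap.compl₂_apply,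
          Submodule.subtype_apply, this, map_zero]
  have h1 : (tripleRel p₁ p₂).liftQ f hk ∘ₗ tripleOfLeft p₁ p₂ = TensorProduct.lift G := by
    apply TensorProduct.ext'
    intro w c
    obtain ⟨t, rfl⟩ := p₁.mkQ_surjective w
    exact LinearMap.congr_fun hf (t ⊗ₜ[ℂ] c)
  have h2 : (tripleRel p₁ p₂).liftQ f hk ∘ₗ tripleOfRight p₁ p₂ = TensorProduct.lift H := by
    apply TensorProduct.ext'
    intro c w
    obtain ⟨t, rfl⟩ := p₂.mkQ_surjective w
    rfl
  have hF' : F = TensorProduct.lift G ∘ₗ LinearMap.rTensor V (TensorProduct.curry L a) :=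
    TensorProduct.ext' hF
  have hK' : K = TensorProduct.lift H ∘ₗ LinearMap.lTensor V ((TensorProduct.curry R).flip c) :=
    TensorProduct.ext' hK
  rw [hF', hK', ← h1, ← h2]
  exact congrArg ((tripleRel p₁ p₂).liftQ f hk) (h a b c r l hr hl)

/-- Co-associativity squares are invariant under reversal of the order of the factors. -/
theorem LegsCommute.reverse {V V' : Type*} [AddCommGroup V] [Module ℂ V] [AddCommGroup V']
    [Module ℂ V'] (u : V' ≃ₗ[ℂ] V) {p₁ p₂ : Submodule ℂ (V ⊗[ℂ] V)}
    {p₁' p₂' : Submodule ℂ (V' ⊗[ℂ] V')} {L : V ⊗[ℂ] V →ₗ[ℂ] (V ⊗[ℂ] V) ⧸ p₁}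
    {R : V ⊗[ℂ] V →ₗ[ℂ] (V ⊗[ℂ] V) ⧸ p₂} {L' : V' ⊗[ℂ] V' →ₗ[ℂ] (V' ⊗[ℂ] V') ⧸ p₁'}
    {R' : V' ⊗[ℂ] V' →ₗ[ℂ] (V' ⊗[ℂ] V') ⧸ p₂'} (e₁ : ((V' ⊗[ℂ] V') ⧸ p₁') ≃ₗ[ℂ] (V ⊗[ℂ] V) ⧸ p₂)
    (e₂ : ((V' ⊗[ℂ] V') ⧸ p₂') ≃ₗ[ℂ] (V ⊗[ℂ] V) ⧸ p₁)
    (he₁ : ∀ a b, e₁ (p₁'.mkQ (a ⊗ₜ[ℂ] b)) = p₂.mkQ (u b ⊗ₜ[ℂ] u a))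
    (he₂ : ∀ a b, e₂ (p₂'.mkQ (a ⊗ₜ[ℂ] b)) = p₁.mkQ (u b ⊗ₜ[ℂ] u a))
    (hL : ∀ a b, e₁ (L' (a ⊗ₜ[ℂ] b)) = R (u b ⊗ₜ[ℂ] u a))
    (hR : ∀ a b, e₂ (R' (a ⊗ₜ[ℂ] b)) = L (u b ⊗ₜ[ℂ] u a)) (h : LegsCommute p₁ p₂ L R) :
    LegsCommute p₁' p₂' L' R' := by
  intro a b c r l hr hl
  let φ : V' ⊗[ℂ] V' ≃ₗ[ℂ] V ⊗[ℂ] V := TensorProduct.comm ℂ V' V' ≪≫ₗ TensorProduct.congr u u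
  have hφ₁ : e₁.toLinearMap ∘ₗ p₁'.mkQ = p₂.mkQ ∘ₗ φ.toLinearMap := TensorProduct.ext' he₁
  have hφ₂ : e₂.toLinearMap ∘ₗ p₂'.mkQ = p₁.mkQ ∘ₗ φ.toLinearMap := TensorProduct.ext' he₂
  have hr' : p₁.mkQ (φ r) = L (u c ⊗ₜ[ℂ] u b) := by
    rw [← hR, ← hr]; exact (LinearMap.congr_fun hφ₂ r).symm
  have hl' : p₂.mkQ (φ l) = R (u b ⊗ₜ[ℂ] u a) := by
    rw [← hL, ← hl]; exact (LinearMap.congr_fun hφ₁ l).symm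
  -- The test maps are the canonical maps onto the triple quotient over `V'` with their arguments
  -- reversed. Evaluating the given square under them yields exactly the square to be proved, with
  -- its two sides interchanged.
  have key := h.apply
    (((TensorProduct.mk ℂ _ _).compr₂ (tripleOfRight p₁' p₂')).compl₁₂ u.symm.toLinearMap
      e₂.symm.toLinearMap).flip
    (((TensorProduct.mk ℂ _ _).compr₂ (tripleOfLeft p₁' p₂')).compl₁₂ e₁.symm.toLinearMap
      u.symm.toLinearMap).flip
    (fun a b c => ?_) hl' hr'
    (F := tripleOfRight p₁' p₂' ∘ₗ LinearMap.lTensor V' ((TensorProduct.curry R').flip c) ∘ₗ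
      φ.symm.toLinearMap)
    (K := tripleOfLeft p₁' p₂' ∘ₗ LinearMap.rTensor V' (TensorProduct.curry L' a) ∘ₗ
      φ.symm.toLinearMap)
    (fun x y => ?_) (fun x y => ?_)
  · simpa using key.symm
  · have h1 : e₂.symm (p₁.mkQ (a ⊗ₜ[ℂ] b)) = p₂'.mkQ (u.symm b ⊗ₜ[ℂ] u.symm a) := by
      rw [LinearEquiv.symm_apply_eq, he₂]; simp
    have h2 : e₁.symm (p₂.mkQ (b ⊗ₜ[ℂ] c)) = p₁'.mkQ (u.symm c ⊗ₜ[ℂ] u.symm b) := by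
      rw [LinearEquiv.symm_apply_eq, he₁]; simp
    simp only [LinearMap.flip_apply, LinearMap.compl₁₂_apply, LinearEquiv.coe_coe, h1, h2]
    rfl
  · have : e₂.symm (L (u c ⊗ₜ[ℂ] x)) = R' (u.symm x ⊗ₜ[ℂ] c) := by
      rw [LinearEquiv.symm_apply_eq, hR]; simp
    simp [φ, this]
  · have : e₁.symm (R (y ⊗ₜ[ℂ] u a)) = L' (a ⊗ₜ[ℂ] u.symm y) := by
      rw [LinearEquiv.symm_apply_eq, hL]; simp
    simp [φ, this]

/-! ### The bi-opposite is a multiplier bialgebroid. -/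

section Biopposite

variable {A : Type*} [NonUnitalRing A] [Module ℂ A] [IsScalarTower ℂ A A] [SMulCommClass ℂ A A]

open Multiplier MulOpposite

/-- Left and right multiplications by multipliers of an idempotent algebra commute. -/
theorem Multiplier.lm_rm_comm
    (hA : Submodule.span ℂ {c : A | ∃ a b, c = a * b} = ⊤) (T U : Multiplier A) (a : A) :
    T.lm (U.rm a) = U.rm (T.lm a) := by
  have : T.lm ∘ₗ U.rm = U.rm ∘ₗ T.lm := by
    refine LinearMap.ext_on hA ?_
    rintro _ ⟨b, c, rfl⟩
    simp only [LinearMap.comp_apply, rm_mul_left, lm_mul_right]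
  exact LinearMap.congr_fun this a

theorem LinearMap.span_image_eq_top {V V' : Type*} [AddCommGroup V] [Module ℂ V]
    [AddCommGroup V'] [Module ℂ V'] (e : V ≃ₗ[ℂ] V') {s : Set V} {t : Set V'}
    (hs : Submodule.span ℂ s = ⊤) (hst : ∀ v ∈ s, e v ∈ t) : Submodule.span ℂ t = ⊤ := by
  have h : Submodule.span ℂ (e '' s) = ⊤ := by
    rw [← LinearEquiv.coe_coe, Submodule.span_image, hs, Submodule.map_top, LinearEquiv.range]
  refine eq_top_mono (Submodule.span_mono ?_) h
  rintro _ ⟨v, hv, rfl⟩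
  exact hst v hv

namespace BaseData

variable (D : BaseData A)

variable {D} in
theorem LT_hom_ext {W : Type*} [AddCommGroup W] [Module ℂ W] {f g : D.LT →ₗ[ℂ] W}
    (h : ∀ a b, f (D.relL.mkQ (a ⊗ₜ[ℂ] b)) = g (D.relL.mkQ (a ⊗ₜ[ℂ] b))) : f = g :=
  Submodule.linearMap_qext _ (TensorProduct.ext' h)

variable {D} in
theorem RT_hom_ext {W : Type*} [AddCommGroup W] [Module ℂ W] {f g : D.RT →ₗ[ℂ] W}
    (h : ∀ a b, f (D.relR.mkQ (a ⊗ₜ[ℂ] b)) = g (D.relR.mkQ (a ⊗ₜ[ℂ] b))) : f = g :=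
  Submodule.linearMap_qext _ (TensorProduct.ext' h)

theorem bioppositeLT_mulFst (c : A) (w : D.biopposite.LT) :
    D.bioppositeLT (D.biopposite.mulFst (op c) w) = D.sndMul c (D.bioppositeLT w) :=
  LinearMap.congr_fun (f := D.bioppositeLT.toLinearMap ∘ₗ D.biopposite.mulFst (op c))
    (g := D.sndMul c ∘ₗ D.bioppositeLT.toLinearMap) (LT_hom_ext fun _ _ => rfl) w

theorem bioppositeLT_mulSnd (c : A) (w : D.biopposite.LT) :
    D.bioppositeLT (D.biopposite.mulSnd (op c) w) = D.fstMul c (D.bioppositeLT w) :=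
  LinearMap.congr_fun (f := D.bioppositeLT.toLinearMap ∘ₗ D.biopposite.mulSnd (op c))
    (g := D.fstMul c ∘ₗ D.bioppositeLT.toLinearMap) (LT_hom_ext fun _ _ => rfl) w

theorem bioppositeRT_fstMul (c : A) (w : D.biopposite.RT) :
    D.bioppositeRT (D.biopposite.fstMul (op c) w) = D.mulSnd c (D.bioppositeRT w) :=
  LinearMap.congr_fun (f := D.bioppositeRT.toLinearMap ∘ₗ D.biopposite.fstMul (op c))
    (g := D.mulSnd c ∘ₗ D.bioppositeRT.toLinearMap) (RT_hom_ext fun _ _ => rfl) w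

theorem bioppositeRT_sndMul (c : A) (w : D.biopposite.RT) :
    D.bioppositeRT (D.biopposite.sndMul (op c) w) = D.mulFst c (D.bioppositeRT w) :=
  LinearMap.congr_fun (f := D.bioppositeRT.toLinearMap ∘ₗ D.biopposite.sndMul (op c))
    (g := D.mulFst c ∘ₗ D.bioppositeRT.toLinearMap) (RT_hom_ext fun _ _ => rfl) w

theorem bioppositeLT_baseMul (x : D.biopposite.C) (y : D.biopposite.B) (w : D.biopposite.LT) :
    D.bioppositeLT (D.biopposite.baseMul x y w) =
      D.mulBase (opSubalgebraEquiv D.C y) (opSubalgebraEquiv D.B x) (D.bioppositeLT w) :=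
  LinearMap.congr_fun (f := D.bioppositeLT.toLinearMap ∘ₗ D.biopposite.baseMul x y)
    (g := D.mulBase (opSubalgebraEquiv D.C y) (opSubalgebraEquiv D.B x) ∘ₗ
      D.bioppositeLT.toLinearMap) (LT_hom_ext fun _ _ => rfl) w

theorem bioppositeRT_mulBase (x : D.biopposite.C) (y : D.biopposite.B) (w : D.biopposite.RT) :
    D.bioppositeRT (D.biopposite.mulBase x y w) =
      D.baseMul (opSubalgebraEquiv D.C y) (opSubalgebraEquiv D.B x) (D.bioppositeRT w) :=
  LinearMap.congr_fun (f := D.bioppositeRT.toLinearMap ∘ₗ D.biopposite.mulBase x y)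
    (g := D.baseMul (opSubalgebraEquiv D.C y) (opSubalgebraEquiv D.B x) ∘ₗ
      D.bioppositeRT.toLinearMap) (RT_hom_ext fun _ _ => rfl) w

end BaseData

namespace MultiplierBialgebroidData

variable {D : MultiplierBialgebroidData A}

theorem bioppositeLT_ΔB (a : A) (w : D.biopposite.LT) :
    D.bioppositeLT (D.biopposite.ΔB (op a) w) = D.ΔC a (D.bioppositeLT w) :=
  D.bioppositeLT.apply_symm_apply _

theorem bioppositeRT_ΔC (a : A) (w : D.biopposite.RT) :
    D.bioppositeRT (D.biopposite.ΔC (op a) w) = D.ΔB a (D.bioppositeRT w) :=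
  D.bioppositeRT.apply_symm_apply _

/-- The canonical map is obtained by choice, so a formula for it needs uniqueness: non-degeneracy of
the tensor product separates any two solutions. The three analogues below serve the same purpose. -/
theorem IsTl.Tl_eq (hnd : ∀ w : D.LT, (∀ c, D.mulSnd c w = 0) → w = 0)
    {T : A ⊗[ℂ] A →ₗ[ℂ] D.LT} (hT : D.IsTl T) : D.Tl = T := by
  have hex : ∃ T, D.IsTl T := ⟨T, hT⟩
  rw [Tl, dif_pos hex]
  refine TensorProduct.ext' fun a b => sub_eq_zero.1 (hnd _ fun c => ?_)
  rw [map_sub, ← hT a b c, ← hex.choose_spec a b c, sub_self]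

theorem IsTr.Tr_eq (hnd : ∀ w : D.LT, (∀ c, D.mulFst c w = 0) → w = 0)
    {T : A ⊗[ℂ] A →ₗ[ℂ] D.LT} (hT : D.IsTr T) : D.Tr = T := by
  have hex : ∃ T, D.IsTr T := ⟨T, hT⟩
  rw [Tr, dif_pos hex]
  refine TensorProduct.ext' fun a b => sub_eq_zero.1 (hnd _ fun c => ?_)
  rw [map_sub, ← hT a b c, ← hex.choose_spec a b c, sub_self]

theorem IslT.lT_eq (hnd : ∀ w : D.RT, (∀ c, D.sndMul c w = 0) → w = 0)
    {T : A ⊗[ℂ] A →ₗ[ℂ] D.RT} (hT : D.IslT T) : D.lT = T := by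
  have hex : ∃ T, D.IslT T := ⟨T, hT⟩
  rw [lT, dif_pos hex]
  refine TensorProduct.ext' fun a b => sub_eq_zero.1 (hnd _ fun c => ?_)
  rw [map_sub, ← hT a b c, ← hex.choose_spec a b c, sub_self]

theorem IsrT.rT_eq (hnd : ∀ w : D.RT, (∀ c, D.fstMul c w = 0) → w = 0)
    {T : A ⊗[ℂ] A →ₗ[ℂ] D.RT} (hT : D.IsrT T) : D.rT = T := by
  have hex : ∃ T, D.IsrT T := ⟨T, hT⟩
  rw [rT, dif_pos hex]
  refine TensorProduct.ext' fun a b => sub_eq_zero.1 (hnd _ fun c => ?_)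
  rw [map_sub, ← hT a b c, ← hex.choose_spec a b c, sub_self]

/-- Taking opposites exchanges the sides of multiplication and the flip exchanges the legs, so the
equation defining `_ρT` turns into the one defining `T_λ`. The other three correspondences arise in
the same way. -/
theorem IsrT.biopposite {T : A ⊗[ℂ] A →ₗ[ℂ] D.RT} (hT : D.IsrT T) : D.biopposite.IsTl
    (D.bioppositeLT.symm.toLinearMap ∘ₗ T ∘ₗ BaseData.unopFlip.toLinearMap) := fun a b c =>
  D.bioppositeLT.injective <|
    (bioppositeLT_ΔB _ _).trans <| (hT b.unop a.unop c.unop).trans <|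
      (congrArg (D.fstMul c.unop) (D.bioppositeLT.apply_symm_apply _).symm).trans (D.bioppositeLT_mulSnd c.unop _).symm

theorem IslT.biopposite {T : A ⊗[ℂ] A →ₗ[ℂ] D.RT} (hT : D.IslT T) : D.biopposite.IsTr
    (D.bioppositeLT.symm.toLinearMap ∘ₗ T ∘ₗ BaseData.unopFlip.toLinearMap) := fun a b c =>
  D.bioppositeLT.injective <|
    (bioppositeLT_ΔB _ _).trans <| (hT b.unop a.unop c.unop).trans <|
      (congrArg (D.sndMul c.unop) (D.bioppositeLT.apply_symm_apply _).symm).trans (D.bioppositeLT_mulFst c.unop _).symm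

theorem IsTr.biopposite {T : A ⊗[ℂ] A →ₗ[ℂ] D.LT} (hT : D.IsTr T) : D.biopposite.IslT
    (D.bioppositeRT.symm.toLinearMap ∘ₗ T ∘ₗ BaseData.unopFlip.toLinearMap) := fun a b c =>
  D.bioppositeRT.injective <|
    (bioppositeRT_ΔC _ _).trans <| (hT b.unop a.unop c.unop).trans <|
      (congrArg (D.mulFst c.unop) (D.bioppositeRT.apply_symm_apply _).symm).trans (D.bioppositeRT_sndMul c.unop _).symm

theorem IsTl.biopposite {T : A ⊗[ℂ] A →ₗ[ℂ] D.LT} (hT : D.IsTl T) : D.biopposite.IsrT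
    (D.bioppositeRT.symm.toLinearMap ∘ₗ T ∘ₗ BaseData.unopFlip.toLinearMap) := fun a b c =>
  D.bioppositeRT.injective <|
    (bioppositeRT_ΔC _ _).trans <| (hT b.unop a.unop c.unop).trans <|
      (congrArg (D.mulSnd c.unop) (D.bioppositeRT.apply_symm_apply _).symm).trans (D.bioppositeRT_fstMul c.unop _).symm

theorem IsRightMultiplierBialgebroid.biopposite_nondegenerate_fst
    (h : D.IsRightMultiplierBialgebroid) (w : D.biopposite.LT)
    (hw : ∀ c, D.biopposite.mulFst c w = 0) : w = 0 :=
  D.bioppositeLT.map_eq_zero_iff.1 <| h.nondegenerate_snd _ fun c =>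
    (D.bioppositeLT_mulFst c w).symm.trans ((congrArg D.bioppositeLT (hw (op c))).trans (map_zero _))

theorem IsRightMultiplierBialgebroid.biopposite_nondegenerate_snd
    (h : D.IsRightMultiplierBialgebroid) (w : D.biopposite.LT)
    (hw : ∀ c, D.biopposite.mulSnd c w = 0) : w = 0 :=
  D.bioppositeLT.map_eq_zero_iff.1 <| h.nondegenerate_fst _ fun c =>
    (D.bioppositeLT_mulSnd c w).symm.trans ((congrArg D.bioppositeLT (hw (op c))).trans (map_zero _))

theorem IsLeftMultiplierBialgebroid.biopposite_nondegenerate_fst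
    (h : D.IsLeftMultiplierBialgebroid) (w : D.biopposite.RT)
    (hw : ∀ c, D.biopposite.fstMul c w = 0) : w = 0 :=
  D.bioppositeRT.map_eq_zero_iff.1 <| h.nondegenerate_snd _ fun c =>
    (D.bioppositeRT_fstMul c w).symm.trans ((congrArg D.bioppositeRT (hw (op c))).trans (map_zero _))

theorem IsLeftMultiplierBialgebroid.biopposite_nondegenerate_snd
    (h : D.IsLeftMultiplierBialgebroid) (w : D.biopposite.RT)
    (hw : ∀ c, D.biopposite.sndMul c w = 0) : w = 0 :=
  D.bioppositeRT.map_eq_zero_iff.1 <| h.nondegenerate_fst _ fun c =>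
    (D.bioppositeRT_sndMul c w).symm.trans ((congrArg D.bioppositeRT (hw (op c))).trans (map_zero _))

theorem IsRightMultiplierBialgebroid.bioppositeLT_Tl (h : D.IsRightMultiplierBialgebroid)
    (a b : Aᵐᵒᵖ) : D.bioppositeLT (D.biopposite.Tl (a ⊗ₜ[ℂ] b)) = D.rT (b.unop ⊗ₜ[ℂ] a.unop) := by
  rw [h.isrT_rT.biopposite.Tl_eq h.biopposite_nondegenerate_snd]
  exact D.bioppositeLT.apply_symm_apply _

theorem IsRightMultiplierBialgebroid.bioppositeLT_Tr (h : D.IsRightMultiplierBialgebroid)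
    (a b : Aᵐᵒᵖ) : D.bioppositeLT (D.biopposite.Tr (a ⊗ₜ[ℂ] b)) = D.lT (b.unop ⊗ₜ[ℂ] a.unop) := by
  rw [h.islT_lT.biopposite.Tr_eq h.biopposite_nondegenerate_fst]
  exact D.bioppositeLT.apply_symm_apply _

theorem IsLeftMultiplierBialgebroid.bioppositeRT_lT (h : D.IsLeftMultiplierBialgebroid)
    (a b : Aᵐᵒᵖ) : D.bioppositeRT (D.biopposite.lT (a ⊗ₜ[ℂ] b)) = D.Tr (b.unop ⊗ₜ[ℂ] a.unop) := by
  rw [h.isTr_Tr.biopposite.lT_eq h.biopposite_nondegenerate_snd]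
  exact D.bioppositeRT.apply_symm_apply _

theorem IsLeftMultiplierBialgebroid.bioppositeRT_rT (h : D.IsLeftMultiplierBialgebroid)
    (a b : Aᵐᵒᵖ) : D.bioppositeRT (D.biopposite.rT (a ⊗ₜ[ℂ] b)) = D.Tl (b.unop ⊗ₜ[ℂ] a.unop) := by
  rw [h.isTl_Tl.biopposite.rT_eq h.biopposite_nondegenerate_fst]
  exact D.bioppositeRT.apply_symm_apply _

theorem IsRightMultiplierBialgebroid.biopposite (h : D.IsRightMultiplierBialgebroid) :
    D.biopposite.IsLeftMultiplierBialgebroid where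
  nondegenerate a ha := unop_injective (h.nondegenerate _ fun b => op_injective (ha (op b)))
  idempotent := LinearMap.span_image_eq_top (opLinearEquiv ℂ) h.idempotent <| by
    rintro _ ⟨a, b, rfl⟩
    exact ⟨op b, op a, rfl⟩
  faithful_left y hy := (opSubalgebraEquiv D.C).injective
    (h.faithful_right _ fun a => op_injective (hy (op a)))
  faithful_right y hy := (opSubalgebraEquiv D.C).injective
    (h.faithful_left _ fun a => op_injective (hy (op a)))
  idempotent_left := LinearMap.span_image_eq_top (opLinearEquiv ℂ) h.idempotent_right <| by
    rintro _ ⟨y, a, rfl⟩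
    exact ⟨(opSubalgebraEquiv D.C).symm y, op a, rfl⟩
  idempotent_right := LinearMap.span_image_eq_top (opLinearEquiv ℂ) h.idempotent_left <| by
    rintro _ ⟨y, a, rfl⟩
    exact ⟨(opSubalgebraEquiv D.C).symm y, op a, rfl⟩
  nondegenerate_fst := h.biopposite_nondegenerate_fst
  nondegenerate_snd := h.biopposite_nondegenerate_snd
  -- The required elements are values of the transported canonical maps.
  mem_takeuchi b a := ⟨⟨_, h.isrT_rT.biopposite a b⟩, ⟨_, h.islT_lT.biopposite b a⟩⟩
  map_mul a b := by
    refine LinearMap.ext fun w => D.bioppositeLT.injective ?_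
    rw [← op_unop a, ← op_unop b, ← op_mul, LinearMap.comp_apply, bioppositeLT_ΔB,
      bioppositeLT_ΔB, bioppositeLT_ΔB, h.map_mul]
    rfl
  map_base y y' x x' a := by
    refine LinearMap.ext fun w => D.bioppositeLT.injective ((bioppositeLT_ΔB _ _).trans ?_)
    have e := h.map_base (opSubalgebraEquiv D.B x') (opSubalgebraEquiv D.B x)
      (opSubalgebraEquiv D.C y') (opSubalgebraEquiv D.C y) a.unop
    refine (congrArg (fun c => D.ΔC c (D.bioppositeLT w)) ?_).trans
      ((LinearMap.congr_fun e (D.bioppositeLT w)).trans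
      ((congrArg _ (congrArg _ (D.bioppositeLT_baseMul x' y' w).symm)).trans
      ((congrArg _ (bioppositeLT_ΔB a.unop _).symm).trans (D.bioppositeLT_baseMul x y _).symm)))
    change (opSubalgebraEquiv D.C y).1.rm ((opSubalgebraEquiv D.B x).1.rm
      ((opSubalgebraEquiv D.B x').1.lm ((opSubalgebraEquiv D.C y').1.lm a.unop))) = _
    -- After reversal the right multiplications are applied last instead of first; interchanging
    -- them with the left ones needs `A` to be idempotent.
    simp only [lm_rm_comm h.idempotent]
  coassoc := LegsCommute.reverse (opLinearEquiv ℂ).symm D.bioppositeLT D.bioppositeLT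
    (fun _ _ => rfl) (fun _ _ => rfl) h.bioppositeLT_Tl h.bioppositeLT_Tr h.coassoc

theorem IsLeftMultiplierBialgebroid.biopposite (h : D.IsLeftMultiplierBialgebroid) :
    D.biopposite.IsRightMultiplierBialgebroid where
  nondegenerate a ha := unop_injective (h.nondegenerate _ fun b => op_injective (ha (op b)))
  idempotent := LinearMap.span_image_eq_top (opLinearEquiv ℂ) h.idempotent <| by
    rintro _ ⟨a, b, rfl⟩
    exact ⟨op b, op a, rfl⟩
  faithful_right y hy := (opSubalgebraEquiv D.B).injective
    (h.faithful_left _ fun a => op_injective (hy (op a)))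
  faithful_left y hy := (opSubalgebraEquiv D.B).injective
    (h.faithful_right _ fun a => op_injective (hy (op a)))
  idempotent_right := LinearMap.span_image_eq_top (opLinearEquiv ℂ) h.idempotent_left <| by
    rintro _ ⟨y, a, rfl⟩
    exact ⟨(opSubalgebraEquiv D.B).symm y, op a, rfl⟩
  idempotent_left := LinearMap.span_image_eq_top (opLinearEquiv ℂ) h.idempotent_right <| by
    rintro _ ⟨y, a, rfl⟩
    exact ⟨(opSubalgebraEquiv D.B).symm y, op a, rfl⟩
  nondegenerate_fst := h.biopposite_nondegenerate_fst
  nondegenerate_snd := h.biopposite_nondegenerate_snd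
  mem_takeuchi b a := ⟨⟨_, h.isTr_Tr.biopposite a b⟩, ⟨_, h.isTl_Tl.biopposite b a⟩⟩
  map_mul a b := by
    refine LinearMap.ext fun w => D.bioppositeRT.injective ?_
    rw [← op_unop a, ← op_unop b, ← op_mul, LinearMap.comp_apply, bioppositeRT_ΔC,
      bioppositeRT_ΔC, bioppositeRT_ΔC, h.map_mul]
    rfl
  map_base y y' x x' a := by
    refine LinearMap.ext fun w => D.bioppositeRT.injective ((bioppositeRT_ΔC _ _).trans ?_)
    have e := h.map_base (opSubalgebraEquiv D.B x') (opSubalgebraEquiv D.B x)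
      (opSubalgebraEquiv D.C y') (opSubalgebraEquiv D.C y) a.unop
    refine (congrArg (fun c => D.ΔB c (D.bioppositeRT w)) ?_).trans
      ((LinearMap.congr_fun e (D.bioppositeRT w)).trans
      ((congrArg _ (congrArg _ (D.bioppositeRT_mulBase x y w).symm)).trans
      ((congrArg _ (bioppositeRT_ΔC a.unop _).symm).trans (D.bioppositeRT_mulBase x' y' _).symm)))
    change (opSubalgebraEquiv D.C y).1.rm ((opSubalgebraEquiv D.B x).1.rm
      ((opSubalgebraEquiv D.B x').1.lm ((opSubalgebraEquiv D.C y').1.lm a.unop))) = _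
    simp only [lm_rm_comm h.idempotent]
  coassoc := LegsCommute.reverse (opLinearEquiv ℂ).symm D.bioppositeRT D.bioppositeRT
    (fun _ _ => rfl) (fun _ _ => rfl) h.bioppositeRT_lT h.bioppositeRT_rT h.coassoc

/-- Each mixed pair, `(T_λ, _ρT)` and `(_λT, T_ρ)`, is sent to itself in reverse order, so neither
mixed condition is exchanged with the other. -/
theorem IsMultiplierBialgebroid.biopposite (h : D.IsMultiplierBialgebroid) :
    D.biopposite.IsMultiplierBialgebroid where
  left := h.right.biopposite
  right := h.left.biopposite
  mixed_left := LegsCommute.reverse (opLinearEquiv ℂ).symm D.bioppositeLT D.bioppositeRT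
    (fun _ _ => rfl) (fun _ _ => rfl) h.right.bioppositeLT_Tl h.left.bioppositeRT_rT h.mixed_left
  mixed_right := LegsCommute.reverse (opLinearEquiv ℂ).symm D.bioppositeRT D.bioppositeLT
    (fun _ _ => rfl) (fun _ _ => rfl) h.left.bioppositeRT_lT h.right.bioppositeLT_Tr h.mixed_right

end MultiplierBialgebroidData

end Biopposite

/-! ### Separate base relations for the comultiplication and the antipode. -/

section Antipode

/-- Lets several idempotent actions be composed: each preserves spanning sets. -/
theorem Submodule.span_map_eq_top {X V : Type*} [AddCommGroup V] [Module ℂ V] (f : X → V →ₗ[ℂ] V)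
    (hf : Submodule.span ℂ {c : V | ∃ x a, c = f x a} = ⊤) {s : Set V}
    (hs : Submodule.span ℂ s = ⊤) :
    Submodule.span ℂ {c : V | ∃ x, ∃ a ∈ s, c = f x a} = ⊤ := by
  rw [eq_top_iff, ← hf, Submodule.span_le]
  rintro _ ⟨x, a, rfl⟩
  have h : (Submodule.span ℂ s).map (f x) ≤ Submodule.span ℂ {c : V | ∃ x, ∃ a ∈ s, c = f x a} := by
    rw [Submodule.map_span_le]
    exact fun a ha => Submodule.subset_span ⟨x, a, ha, rfl⟩
  exact h ⟨a, hs ▸ Submodule.mem_top, rfl⟩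

/-- A map `u ⊗ v` that is compatible with the actions preserves the balancing relations. -/
theorem balancedRel_map_le {X Y V : Type*} [AddCommGroup V] [Module ℂ V] {f g : X → V →ₗ[ℂ] V}
    {f' g' : Y → V →ₗ[ℂ] V} (u v : V →ₗ[ℂ] V) (e : X → Y)
    (hu : ∀ x a, u (f x a) = f' (e x) (u a)) (hv : ∀ x a, v (g x a) = g' (e x) (v a)) :
    balancedRel f g ≤ (balancedRel f' g').comap (TensorProduct.map u v) :=
  balancedRel_le _ _ fun x a b => by
    simpa only [TensorProduct.map_tmul, hu, hv] using balancedRel_mem (e x) (u a) (v b)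

variable {A : Type*} [NonUnitalRing A] [Module ℂ A] [IsScalarTower ℂ A A] [SMulCommClass ℂ A A]

open Multiplier MulOpposite

namespace MultiplierBialgebroidData

variable {D : MultiplierBialgebroidData A}

section LeftBialgebroid

variable (h : D.IsLeftMultiplierBialgebroid)

include h

theorem IsLeftMultiplierBialgebroid.ΔB_mulFst (a c : A) (w : D.LT) :
    D.ΔB a (D.mulFst c w) = D.mulFst c (D.ΔB a w) := by
  refine LinearMap.congr_fun (f := D.ΔB a ∘ₗ D.mulFst c) (g := D.mulFst c ∘ₗ D.ΔB a)
    (BaseData.LT_hom_ext fun d b => ?_) w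
  have e : ∀ w, D.mulFst c (D.mulFst d w) = D.mulFst (d * c) w := fun w =>
    LinearMap.congr_fun (f := D.mulFst c ∘ₗ D.mulFst d) (g := D.mulFst (d * c))
      (BaseData.LT_hom_ext fun p q => congrArg (fun r => D.relL.mkQ (r ⊗ₜ[ℂ] q))
        (mul_assoc p d c)) w
  exact (h.isTr_Tr a b (d * c)).trans
    ((e _).symm.trans (congrArg (D.mulFst c) (h.isTr_Tr a b d).symm))

/-- Multiplication by `c ⊗ 1` on the right commutes with `Δ_B(b)` and separates points, which
reduces the claim to multiplicativity of `Δ_B`. -/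
theorem IsLeftMultiplierBialgebroid.Tr_mul (b p q : A) :
    D.Tr ((b * p) ⊗ₜ[ℂ] q) = D.ΔB b (D.Tr (p ⊗ₜ[ℂ] q)) := by
  refine sub_eq_zero.1 (h.nondegenerate_fst _ fun c => ?_)
  rw [map_sub, ← h.ΔB_mulFst, ← h.isTr_Tr, ← h.isTr_Tr, h.map_mul]
  exact sub_self _

end LeftBialgebroid

section Bialgebroid

variable (h : D.IsMultiplierBialgebroid)

include h

/-- A substitute for units in the base. The axioms treat all four base actions at once; on elements
`x y a y' x'` one further base element is absorbed into an existing factor, which isolates its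
individual effect. -/
theorem IsMultiplierBialgebroid.span_base : Submodule.span ℂ {c : A | ∃ (x : D.B) (y : D.C)
    (y' : D.C) (x' : D.B) (a : A), c = lm x.1 (lm y.1 (rm y'.1 (rm x'.1 a)))} = ⊤ := by
  have h1 : Submodule.span ℂ {c : A | ∃ (y : D.C) (a : A), c = lm y.1 a} = ⊤ := by
    refine eq_top_mono (Submodule.span_mono ?_) h.left.idempotent_right
    rintro _ ⟨x, a, rfl⟩
    exact ⟨_, a, rfl⟩
  have h2 : Submodule.span ℂ {c : A | ∃ (x : D.B) (a : A), c = rm x.1 a} = ⊤ := by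
    refine eq_top_mono (Submodule.span_mono ?_) h.right.idempotent_left
    rintro _ ⟨y, a, rfl⟩
    exact ⟨_, a, rfl⟩
  refine eq_top_mono (Submodule.span_mono ?_) (Submodule.span_map_eq_top _ h.left.idempotent_left
    (Submodule.span_map_eq_top _ h1 (Submodule.span_map_eq_top _ h.right.idempotent_right h2)))
  rintro _ ⟨x, _, ⟨y, _, ⟨y', _, ⟨x', a, rfl⟩, rfl⟩, rfl⟩, rfl⟩
  exact ⟨x, y, y', x', a, rfl⟩

theorem IsMultiplierBialgebroid.ΔB_rm (y : D.C) (b c d : A) :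
    D.ΔB (rm y.1 b) (D.relL.mkQ (c ⊗ₜ[ℂ] d)) = D.ΔB b (D.relL.mkQ (lm y.1 c ⊗ₜ[ℂ] d)) := by
  refine LinearMap.congr_fun (f := D.ΔB.flip (D.relL.mkQ (c ⊗ₜ[ℂ] d)) ∘ₗ rm y.1)
    (g := D.ΔB.flip (D.relL.mkQ (lm y.1 c ⊗ₜ[ℂ] d))) (LinearMap.ext_on h.span_base ?_) b
  rintro _ ⟨x, y₁, y₂, x', a, rfl⟩
  have e : rm y.1 (lm x.1 (lm y₁.1 (rm y₂.1 (rm x'.1 a)))) =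
      lm x.1 (lm y₁.1 (rm (y₂ * y).1 (rm x'.1 a))) := by
    simp only [← lm_rm_comm h.left.idempotent]
    rfl
  simp only [LinearMap.comp_apply, LinearMap.flip_apply]
  rw [e, h.left.map_base, h.left.map_base]
  rfl

end Bialgebroid

variable {S : A ≃ₗ[ℂ] A}

section BaseRelations

variable (h : D.IsMultiplierBialgebroid) (hS : D.IsInvertibleAntipode S)

include h hS

/-- On the spanning elements the extra `x` merges with the first factor, and anti-multiplicativity
of `S_B` splits it off again after `S`. The three relations below follow the same pattern for the
other actions. -/
theorem IsInvertibleAntipode.map_lm_B (x : D.B) (a : A) :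
    S (lm x.1 a) = rm (D.SB x).1 (S a) := by
  refine LinearMap.congr_fun (f := S.toLinearMap ∘ₗ lm x.1)
    (g := rm (D.SB x).1 ∘ₗ S.toLinearMap) (LinearMap.ext_on h.span_base ?_) a
  rintro _ ⟨x₁, y, y', x', a, rfl⟩
  refine (hS.map_base (x * x₁) x' y y' a).trans ?_
  simp only [LinearMap.comp_apply, LinearEquiv.coe_coe, hS.map_base, D.SB_mul,
    ← lm_rm_comm h.left.idempotent]
  rfl

theorem IsInvertibleAntipode.map_lm_C (y : D.C) (a : A) :
    S (lm y.1 a) = rm (D.SC y).1 (S a) := by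
  refine LinearMap.congr_fun (f := S.toLinearMap ∘ₗ lm y.1)
    (g := rm (D.SC y).1 ∘ₗ S.toLinearMap) (LinearMap.ext_on h.span_base ?_) a
  rintro _ ⟨x, y₁, y', x', a, rfl⟩
  rw [LinearMap.comp_apply, ← D.lm_comm]
  refine (hS.map_base x x' (y * y₁) y' a).trans ?_
  simp only [LinearMap.comp_apply, LinearEquiv.coe_coe, hS.map_base, D.SC_mul,
    ← lm_rm_comm h.left.idempotent, D.rm_comm]
  rfl

theorem IsInvertibleAntipode.map_rm_C (y : D.C) (a : A) :
    S (rm y.1 a) = lm (D.SC y).1 (S a) := by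
  refine LinearMap.congr_fun (f := S.toLinearMap ∘ₗ rm y.1)
    (g := lm (D.SC y).1 ∘ₗ S.toLinearMap) (LinearMap.ext_on h.span_base ?_) a
  rintro _ ⟨x, y₁, y', x', a, rfl⟩
  rw [LinearMap.comp_apply, ← lm_rm_comm h.left.idempotent, ← lm_rm_comm h.left.idempotent]
  refine (hS.map_base x x' y₁ (y' * y) a).trans ?_
  simp only [LinearMap.comp_apply, LinearEquiv.coe_coe, hS.map_base, D.SC_mul]
  rfl

theorem IsInvertibleAntipode.map_rm_B (x : D.B) (a : A) :
    S (rm x.1 a) = lm (D.SB x).1 (S a) := by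
  refine LinearMap.congr_fun (f := S.toLinearMap ∘ₗ rm x.1)
    (g := lm (D.SB x).1 ∘ₗ S.toLinearMap) (LinearMap.ext_on h.span_base ?_) a
  rintro _ ⟨x₁, y₁, y', x', a, rfl⟩
  rw [LinearMap.comp_apply, ← lm_rm_comm h.left.idempotent, ← lm_rm_comm h.left.idempotent,
    D.rm_comm]
  refine (hS.map_base x₁ (x' * x) y₁ y' a).trans ?_
  simp only [LinearMap.comp_apply, LinearEquiv.coe_coe, hS.map_base, D.SB_mul, ← D.lm_comm]
  rfl

end BaseRelations

end MultiplierBialgebroidData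

end Antipode

/-! ### Inversion of the canonical maps by the antipode, and reversal of the comultiplications. -/

section AntipodeIdentities

variable {A : Type*} [NonUnitalRing A] [Module ℂ A] [IsScalarTower ℂ A A] [SMulCommClass ℂ A A]

open Multiplier MulOpposite

namespace BaseData

variable (D : BaseData A)

/-- The bilinear map `(c, w) ↦ w (c ⊗ 1)`. -/
def mulFstHom : A →ₗ[ℂ] D.LT →ₗ[ℂ] D.LT :=
  LinearMap.mk₂ ℂ (fun c w => D.mulFst c w)
    (fun c c' w => LinearMap.congr_fun (f := D.mulFst (c + c')) (g := D.mulFst c + D.mulFst c')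
      (LT_hom_ext fun p q => by
        change D.relL.mkQ ((p * (c + c')) ⊗ₜ[ℂ] q) =
          D.relL.mkQ ((p * c) ⊗ₜ[ℂ] q) + D.relL.mkQ ((p * c') ⊗ₜ[ℂ] q)
        rw [mul_add, TensorProduct.add_tmul, map_add]) w)
    (fun k c w => LinearMap.congr_fun (f := D.mulFst (k • c)) (g := k • D.mulFst c)
      (LT_hom_ext fun p q => by
        change D.relL.mkQ ((p * (k • c)) ⊗ₜ[ℂ] q) = k • D.relL.mkQ ((p * c) ⊗ₜ[ℂ] q)
        rw [mul_smul_comm, ← TensorProduct.smul_tmul', map_smul]) w)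
    (fun _ _ _ => map_add _ _ _) (fun _ _ _ => map_smul _ _ _)

/-- The bilinear map `(c, w) ↦ w (1 ⊗ c)`. -/
def mulSndHom : A →ₗ[ℂ] D.LT →ₗ[ℂ] D.LT :=
  LinearMap.mk₂ ℂ (fun c w => D.mulSnd c w)
    (fun c c' w => LinearMap.congr_fun (f := D.mulSnd (c + c')) (g := D.mulSnd c + D.mulSnd c')
      (LT_hom_ext fun p q => by
        change D.relL.mkQ (p ⊗ₜ[ℂ] (q * (c + c'))) =
          D.relL.mkQ (p ⊗ₜ[ℂ] (q * c)) + D.relL.mkQ (p ⊗ₜ[ℂ] (q * c'))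
        rw [mul_add, TensorProduct.tmul_add, map_add]) w)
    (fun k c w => LinearMap.congr_fun (f := D.mulSnd (k • c)) (g := k • D.mulSnd c)
      (LT_hom_ext fun p q => by
        change D.relL.mkQ (p ⊗ₜ[ℂ] (q * (k • c))) = k • D.relL.mkQ (p ⊗ₜ[ℂ] (q * c))
        rw [mul_smul_comm, TensorProduct.tmul_smul, map_smul]) w)
    (fun _ _ _ => map_add _ _ _) (fun _ _ _ => map_smul _ _ _)

/-- The bilinear map `(c, w) ↦ (c ⊗ 1) w`. -/
def fstMulHom : A →ₗ[ℂ] D.RT →ₗ[ℂ] D.RT :=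
  LinearMap.mk₂ ℂ (fun c w => D.fstMul c w)
    (fun c c' w => LinearMap.congr_fun (f := D.fstMul (c + c')) (g := D.fstMul c + D.fstMul c')
      (RT_hom_ext fun p q => by
        change D.relR.mkQ (((c + c') * p) ⊗ₜ[ℂ] q) =
          D.relR.mkQ ((c * p) ⊗ₜ[ℂ] q) + D.relR.mkQ ((c' * p) ⊗ₜ[ℂ] q)
        rw [add_mul, TensorProduct.add_tmul, map_add]) w)
    (fun k c w => LinearMap.congr_fun (f := D.fstMul (k • c)) (g := k • D.fstMul c)
      (RT_hom_ext fun p q => by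
        change D.relR.mkQ (((k • c) * p) ⊗ₜ[ℂ] q) = k • D.relR.mkQ ((c * p) ⊗ₜ[ℂ] q)
        rw [smul_mul_assoc, ← TensorProduct.smul_tmul', map_smul]) w)
    (fun _ _ _ => map_add _ _ _) (fun _ _ _ => map_smul _ _ _)

theorem relL_mkQ_eq (x : D.B) (a b : A) :
    D.relL.mkQ (lm x.1 a ⊗ₜ[ℂ] b) = D.relL.mkQ (a ⊗ₜ[ℂ] lm (D.SB x).1 b) :=
  (Submodule.Quotient.eq _).2 (balancedRel_mem x a b)

theorem relR_mkQ_eq (y : D.C) (a b : A) :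
    D.relR.mkQ (rm (D.SC y).1 a ⊗ₜ[ℂ] b) = D.relR.mkQ (a ⊗ₜ[ℂ] rm y.1 b) :=
  (Submodule.Quotient.eq _).2 (balancedRel_mem y a b)

end BaseData

namespace MultiplierBialgebroidData

variable {D : MultiplierBialgebroidData A} {S : A ≃ₗ[ℂ] A}

section Fold

variable (hS : D.IsInvertibleAntipode S)

include hS

theorem IsInvertibleAntipode.relL_le : D.relL ≤ LinearMap.ker
    (LinearMap.mul' ℂ A ∘ₗ TensorProduct.map S.toLinearMap LinearMap.id) := by
  obtain ⟨_, _, _, _, ⟨h, _⟩, _⟩ := hS.exists_counits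
  exact h

theorem IsInvertibleAntipode.relR_le : D.relR ≤ LinearMap.ker
    (LinearMap.mul' ℂ A ∘ₗ TensorProduct.map LinearMap.id S.toLinearMap) := by
  obtain ⟨_, _, _, _, _, ⟨h, _⟩⟩ := hS.exists_counits
  exact h

/-- The map `_B A ⊗ A^B → A`, `a ⊗ b ↦ S(a) b`. -/
def IsInvertibleAntipode.foldL : D.LT →ₗ[ℂ] A := D.relL.liftQ _ hS.relL_le

/-- The map `^C A ⊗ A_C → A`, `a ⊗ b ↦ a S(b)`. -/
def IsInvertibleAntipode.foldR : D.RT →ₗ[ℂ] A := D.relR.liftQ _ hS.relR_le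

theorem IsInvertibleAntipode.foldL_mulSnd (c : A) (w : D.LT) :
    hS.foldL (D.mulSnd c w) = hS.foldL w * c :=
  LinearMap.congr_fun (f := hS.foldL ∘ₗ D.mulSnd c) (g := LinearMap.mulRight ℂ c ∘ₗ hS.foldL)
    (BaseData.LT_hom_ext fun a b => (mul_assoc (S a) b c).symm) w

theorem IsInvertibleAntipode.foldL_mulFst (c : A) (w : D.LT) :
    hS.foldL (D.mulFst c w) = S c * hS.foldL w :=
  LinearMap.congr_fun (f := hS.foldL ∘ₗ D.mulFst c) (g := LinearMap.mulLeft ℂ (S c) ∘ₗ hS.foldL)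
    (BaseData.LT_hom_ext fun a b => (congrArg (· * b) (hS.map_mul a c)).trans
      (mul_assoc (S c) (S a) b)) w

theorem IsInvertibleAntipode.foldR_fstMul (c : A) (w : D.RT) :
    hS.foldR (D.fstMul c w) = c * hS.foldR w :=
  LinearMap.congr_fun (f := hS.foldR ∘ₗ D.fstMul c) (g := LinearMap.mulLeft ℂ c ∘ₗ hS.foldR)
    (BaseData.RT_hom_ext fun a b => mul_assoc c a (S b)) w

theorem IsInvertibleAntipode.foldR_sndMul (c : A) (w : D.RT) :
    hS.foldR (D.sndMul c w) = hS.foldR w * S c :=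
  LinearMap.congr_fun (f := hS.foldR ∘ₗ D.sndMul c) (g := LinearMap.mulRight ℂ (S c) ∘ₗ hS.foldR)
    (BaseData.RT_hom_ext fun a b => (congrArg (a * ·) (hS.map_mul c b)).trans
      (mul_assoc a (S b) (S c)).symm) w

end Fold

variable (h : D.IsRegularMultiplierHopfAlgebroid)

include h

/-- The antipode axiom concerns `_λT`. Multiplying by `d` on the left passes through `(d ⊗
b)Δ_C(a)`, which can be expressed by either `_ρT` or `_λT`; in the latter form `b` leaves the fold
as `S(b)` on the right. Non-degeneracy then removes `d`. -/
theorem IsInvertibleAntipode.foldR_rT (hS : D.IsInvertibleAntipode S) {εB : A →ₗ[ℂ] D.B}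
    (hε : ∀ a b, hS.foldR (D.lT (a ⊗ₜ[ℂ] b)) = rm (D.SB (εB b)).1 a) (a b : A) :
    hS.foldR (D.rT (a ⊗ₜ[ℂ] b)) = lm (D.SB (εB a)).1 (S b) := by
  have hb := h.isMultiplierBialgebroid
  refine sub_eq_zero.1 (hb.right.nondegenerate _ fun d => ?_)
  rw [mul_sub, ← hS.foldR_fstMul, ← hb.right.isrT_rT, hb.right.islT_lT, hS.foldR_sndMul, hε,
    mul_lm, sub_self]

theorem IsInvertibleAntipode.foldL_Tl (hS : D.IsInvertibleAntipode S) {εC : A →ₗ[ℂ] D.C}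
    (hε : ∀ a b, hS.foldL (D.Tr (a ⊗ₜ[ℂ] b)) = lm (D.SC (εC a)).1 b) (a b : A) :
    hS.foldL (D.Tl (a ⊗ₜ[ℂ] b)) = rm (D.SC (εC b)).1 (S a) := by
  have hb := h.isMultiplierBialgebroid
  refine sub_eq_zero.1 (hb.left.nondegenerate _ fun d => ?_)
  rw [sub_mul, ← hS.foldL_mulSnd, ← hb.left.isTl_Tl, hb.left.isTr_Tr, hS.foldL_mulFst, hε,
    mul_lm, sub_self]

variable (hS : D.IsInvertibleAntipode S)

include hS

/-- After multiplication by `c ⊗ 1`, mixed co-associativity moves the computation from `_ρT(a ⊗ b)`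
to `T_λ(c ⊗ a)`. There the antipode axiom produces `S_B(ε_B(·))`, which crosses the balanced tensor
sign, and the counit property contracts `T_λ(c ⊗ a)` to `ac`. -/
theorem IsInvertibleAntipode.Tr_map_eq {a b : A} {r : A ⊗[ℂ] A}
    (hr : D.relR.mkQ r = D.rT (a ⊗ₜ[ℂ] b)) :
    D.Tr (TensorProduct.map LinearMap.id S.toLinearMap r) = D.relL.mkQ (a ⊗ₜ[ℂ] S b) := by
  have hb := h.isMultiplierBialgebroid
  obtain ⟨εB, εC, hB, hC, ⟨_, h1⟩, ⟨_, h2⟩⟩ := hS.exists_counits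
  refine sub_eq_zero.1 (hb.left.nondegenerate_fst _ fun c => ?_)
  obtain ⟨l, hl⟩ := D.relL.mkQ_surjective (D.Tl (c ⊗ₜ[ℂ] a))
  have key := hb.mixed_left.apply (D.mulSndHom ∘ₗ S.toLinearMap).flip
    (((TensorProduct.mk ℂ A A).compr₂ D.relL.mkQ).compl₂ hS.foldR) (fun p q r => rfl) hr hl
    (F := D.mulFst c ∘ₗ D.Tr ∘ₗ TensorProduct.map LinearMap.id S.toLinearMap)
    (K := D.relL.mkQ ∘ₗ (TensorProduct.mk ℂ A A).flip (S b) ∘ₗ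
      D.leftSliceSnd εB hB.map_right ∘ₗ D.relL.mkQ)
    (fun x y => (hb.left.isTr_Tr x (S y) c).symm.trans (hb.left.isTl_Tl c x (S y)))
    (fun x y => by
      refine (D.relL_mkQ_eq (εB y) x (S b)).trans ?_
      exact congrArg (fun d => D.relL.mkQ (x ⊗ₜ[ℂ] d)) (hS.foldR_rT h h2 y b).symm)
  simp only [LinearMap.comp_apply, hl, hB.slice_snd] at key
  rw [map_sub, key]
  exact sub_self _

/-- Mirror argument on the same mixed square, with the right counit contracting `_ρT(b ⊗ d)` to
`db`. -/
theorem IsInvertibleAntipode.lT_map_eq {a b : A} {l : A ⊗[ℂ] A}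
    (hl : D.relL.mkQ l = D.Tl (a ⊗ₜ[ℂ] b)) :
    D.lT (TensorProduct.map S.toLinearMap LinearMap.id l) = D.relR.mkQ (S a ⊗ₜ[ℂ] b) := by
  have hb := h.isMultiplierBialgebroid
  obtain ⟨εB, εC, hB, hC, ⟨_, h1⟩, ⟨_, h2⟩⟩ := hS.exists_counits
  refine sub_eq_zero.1 (hb.right.nondegenerate_snd _ fun d => ?_)
  obtain ⟨r, hr⟩ := D.relR.mkQ_surjective (D.rT (b ⊗ₜ[ℂ] d))
  have key := hb.mixed_left.apply (((TensorProduct.mk ℂ A A).compr₂ D.relR.mkQ) ∘ₗ hS.foldL)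
    (D.fstMulHom ∘ₗ S.toLinearMap) (fun p q r => rfl) hr hl
    (F := D.relR.mkQ ∘ₗ TensorProduct.mk ℂ A A (S a) ∘ₗ
      D.rightSliceFst εC hC.map_left ∘ₗ D.relR.mkQ)
    (K := D.sndMul d ∘ₗ D.lT ∘ₗ TensorProduct.map S.toLinearMap LinearMap.id)
    (fun x y => by
      refine (D.relR_mkQ_eq (εC x) (S a) y).symm.trans ?_
      exact congrArg (fun d => D.relR.mkQ (d ⊗ₜ[ℂ] y)) (hS.foldL_Tl h h1 a x).symm)
    (fun x y => (hb.right.islT_lT (S x) y d).symm.trans (hb.right.isrT_rT y d (S x)))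
  simp only [LinearMap.comp_apply, hr, hC.slice_fst] at key
  rw [map_sub, ← key]
  exact sub_self _

/-- The isomorphism `^C A ⊗ A_C → A_B ⊗ _B A`, `a ⊗ b ↦ a ⊗ S(b)`, followed by `T_ρ`. -/
noncomputable def IsInvertibleAntipode.galois : D.RT →ₗ[ℂ] D.LT :=
  D.relR.liftQ (D.Tr ∘ₗ TensorProduct.map LinearMap.id S.toLinearMap) <| by
    rw [LinearMap.ker_comp]
    refine le_trans ?_ (Submodule.comap_mono h.bijective_Tr.choose)
    exact balancedRel_map_le _ _ D.SC (fun _ _ => rfl)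
      (hS.map_rm_C h.isMultiplierBialgebroid)

/-- Since `S(by) = S_C(y)S(b)`, the map `ι ⊗ S` carries the relations of `^C A ⊗ A_C` onto those of
the source of `T_ρ`; its inverse on representatives is `ι ⊗ S⁻¹`, and `T_ρ` is injective on that
quotient. -/
theorem IsInvertibleAntipode.galois_injective : Function.Injective (hS.galois h) := by
  refine (injective_iff_map_eq_zero _).2 fun w hw => ?_
  obtain ⟨t, rfl⟩ := D.relR.mkQ_surjective w
  obtain ⟨hle, hbij⟩ := h.bijective_Tr
  have h1 := (Submodule.Quotient.mk_eq_zero _).1 ((injective_iff_map_eq_zero _).1 hbij.1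
    (Submodule.Quotient.mk (TensorProduct.map LinearMap.id S.toLinearMap t)) hw)
  have h2 := balancedRel_map_le (f' := fun y : D.C => rm (D.SC y).1) (g' := fun y : D.C => rm y.1)
    LinearMap.id S.symm.toLinearMap D.SC.symm
    (fun x a => by simp) (fun x a => by
      refine S.injective ?_
      rw [hS.map_rm_C h.isMultiplierBialgebroid]
      simp) h1
  refine (Submodule.Quotient.mk_eq_zero _).2 ?_
  have h3 : TensorProduct.map LinearMap.id S.symm.toLinearMap
      (TensorProduct.map LinearMap.id S.toLinearMap t) = t := by
    rw [← LinearMap.comp_apply, ← TensorProduct.map_comp]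
    simp
  rw [Submodule.mem_comap, h3] at h2
  exact h2

theorem IsInvertibleAntipode.galois_rT (a b : A) :
    hS.galois h (D.rT (a ⊗ₜ[ℂ] b)) = D.relL.mkQ (a ⊗ₜ[ℂ] S b) := by
  obtain ⟨r, hr⟩ := D.relR.mkQ_surjective (D.rT (a ⊗ₜ[ℂ] b))
  rw [← hr]
  exact hS.Tr_map_eq h hr

theorem IsInvertibleAntipode.galois_fstMul (p : A) (w : D.RT) :
    hS.galois h (D.fstMul p w) = D.ΔB p (hS.galois h w) :=
  LinearMap.congr_fun (f := hS.galois h ∘ₗ D.fstMul p) (g := D.ΔB p ∘ₗ hS.galois h)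
    (BaseData.RT_hom_ext fun a b => h.isMultiplierBialgebroid.left.Tr_mul p a (S b)) w

/-- Every `z` has the form `g(w)` with `w` in the range of `_ρT`, as `S` is surjective. Then `0 =
Δ_B(p)z = g((p ⊗ 1)w)`, so `(p ⊗ 1)w = 0` for all `p`, and `w = 0` by non-degeneracy. -/
theorem IsInvertibleAntipode.eq_zero_of_ΔB (z : D.LT) (hz : ∀ p, D.ΔB p z = 0) : z = 0 := by
  have hmap : D.relL.mkQ ∘ₗ TensorProduct.map LinearMap.id S.toLinearMap =
      hS.galois h ∘ₗ D.rT := TensorProduct.ext' fun a b => (hS.galois_rT h a b).symm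
  obtain ⟨t, rfl⟩ := D.relL.mkQ_surjective z
  obtain ⟨t, rfl⟩ := (TensorProduct.congr (LinearEquiv.refl ℂ A) S).surjective t
  have e : D.relL.mkQ (TensorProduct.congr (LinearEquiv.refl ℂ A) S t) = hS.galois h (D.rT t) :=
    LinearMap.congr_fun hmap t
  rw [e] at hz ⊢
  rw [h.isMultiplierBialgebroid.right.nondegenerate_fst (D.rT t) fun p => ?_, map_zero]
  refine (injective_iff_map_eq_zero _).1 (hS.galois_injective h) _ ?_
  rw [hS.galois_fstMul, hz]

/-- The map `^C A ⊗ A_C → _B A ⊗ A^B`, `a ⊗ b ↦ S(b) ⊗ S(a)`. -/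
def IsInvertibleAntipode.twistR : D.RT →ₗ[ℂ] D.LT :=
  D.relR.liftQ (D.relL.mkQ ∘ₗ (TensorProduct.comm ℂ A A).toLinearMap ∘ₗ
      TensorProduct.map S.toLinearMap S.toLinearMap) <|
    balancedRel_le _ ⊥ fun y a b => by
      have hb := h.isMultiplierBialgebroid
      have e := D.relL_mkQ_eq (D.SC y) (S b) (S a)
      rw [← hS.map_rm_C hb, ← hS.map_rm_B hb] at e
      exact (Submodule.mem_bot ℂ).2 (sub_eq_zero.2 e.symm)

/-- The map `_B A ⊗ A^B → ^C A ⊗ A_C`, `a ⊗ b ↦ S(b) ⊗ S(a)`. -/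
def IsInvertibleAntipode.twistL : D.LT →ₗ[ℂ] D.RT :=
  D.relL.liftQ (D.relR.mkQ ∘ₗ (TensorProduct.comm ℂ A A).toLinearMap ∘ₗ
      TensorProduct.map S.toLinearMap S.toLinearMap) <|
    balancedRel_le _ ⊥ fun x a b => by
      have hb := h.isMultiplierBialgebroid
      have e := D.relR_mkQ_eq (D.SB x) (S b) (S a)
      rw [← hS.map_lm_C hb, ← hS.map_lm_B hb] at e
      exact (Submodule.mem_bot ℂ).2 (sub_eq_zero.2 e.symm)

theorem IsInvertibleAntipode.twistR_sndMul (c : A) (w : D.RT) :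
    hS.twistR h (D.sndMul c w) = D.mulFst (S c) (hS.twistR h w) :=
  LinearMap.congr_fun (f := hS.twistR h ∘ₗ D.sndMul c) (g := D.mulFst (S c) ∘ₗ hS.twistR h)
    (BaseData.RT_hom_ext fun a b => congrArg (fun d => D.relL.mkQ (d ⊗ₜ[ℂ] S a))
      (hS.map_mul c b)) w

theorem IsInvertibleAntipode.twistL_mulSnd (c : A) (w : D.LT) :
    hS.twistL h (D.mulSnd c w) = D.fstMul (S c) (hS.twistL h w) :=
  LinearMap.congr_fun (f := hS.twistL h ∘ₗ D.mulSnd c) (g := D.fstMul (S c) ∘ₗ hS.twistL h)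
    (BaseData.LT_hom_ext fun a b => congrArg (fun d => D.relR.mkQ (d ⊗ₜ[ℂ] S a))
      (hS.map_mul b c)) w

/-- The difference of the two candidates for `Δ_B(S(a))` vanishes on the range of `_λT`. -/
theorem IsInvertibleAntipode.ΔB_twistR_of_lT (u v a b : A) {l : A ⊗[ℂ] A}
    (hl : D.relR.mkQ l = D.lT (b ⊗ₜ[ℂ] a)) :
    TensorProduct.lift (LinearMap.mk₂ ℂ (fun p q => D.ΔB p
        (hS.twistR h (D.ΔC q (D.relR.mkQ (u ⊗ₜ[ℂ] v)))))
        (by intros; simp only [map_add, LinearMap.add_apply])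
        (by intros; simp only [map_smul, LinearMap.smul_apply])
        (by intros; simp only [map_add, LinearMap.add_apply])
        (by intros; simp only [map_smul, LinearMap.smul_apply])) l =
      D.ΔB (hS.foldR (D.relR.mkQ l)) (D.relL.mkQ (S v ⊗ₜ[ℂ] S u)) := by
  have hb := h.isMultiplierBialgebroid
  obtain ⟨εB, εC, hB, hC, ⟨_, h1⟩, ⟨_, h2⟩⟩ := hS.exists_counits
  obtain ⟨r, hr⟩ := D.relR.mkQ_surjective (D.rT (a ⊗ₜ[ℂ] v))
  -- The two test maps agree because both send `p ⊗ q ⊗ r` to `Δ_B(p)(S(r) ⊗ S(uq))`. On one side of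
  -- the square `galois_rT` reduces the expression to `Δ_B(b)(x S(y) ⊗ S(u))`, summed over `_ρT(a ⊗
  -- v)`; the other side is the sum to be computed.
  have key := hb.right.coassoc.apply
    (((D.mulFstHom ∘ₗ S.toLinearMap).compl₂ (hS.galois h ∘ₗ D.sndMul u)).flip)
    (LinearMap.compl₂ (M := A) D.ΔB (hS.twistR h ∘ₗ D.fstMul u))
    (fun p q r => (hb.left.isTr_Tr p (S (u * q)) (S r)).symm) hr hl
    (F := D.ΔB b ∘ₗ D.relL.mkQ ∘ₗ (TensorProduct.mk ℂ A A).flip (S u) ∘ₗ hS.foldR ∘ₗ D.relR.mkQ)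
    (K := TensorProduct.lift (LinearMap.mk₂ ℂ (fun p q => D.ΔB p
        (hS.twistR h (D.ΔC q (D.relR.mkQ (u ⊗ₜ[ℂ] v)))))
        (by intros; simp only [map_add, LinearMap.add_apply])
        (by intros; simp only [map_smul, LinearMap.smul_apply])
        (by intros; simp only [map_add, LinearMap.add_apply])
        (by intros; simp only [map_smul, LinearMap.smul_apply])))
    (fun x y => by
      change D.ΔB b (D.mulFst (S y) (D.relL.mkQ (x ⊗ₜ[ℂ] S u))) =
        D.mulFst (S y) (hS.galois h (D.sndMul u (D.lT (b ⊗ₜ[ℂ] x))))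
      rw [hb.left.ΔB_mulFst, ← hb.right.islT_lT, hb.right.isrT_rT, hS.galois_fstMul,
        hS.galois_rT])
    (fun x y => congrArg (fun w => D.ΔB x (hS.twistR h w)) (hb.right.isrT_rT y v u))
  rw [← key, hl]
  -- Both folds produce the factor `S_B(ε_B(a))`: on one side to the right of `b` inside `Δ_B`, on
  -- the other to the left of `S(v)` in the first leg. `ΔB_rm` matches the two.
  have e : hS.foldR (D.lT (b ⊗ₜ[ℂ] a)) = rm (D.SB (εB a)).1 b := h2 b a
  rw [e, hb.ΔB_rm]
  simp only [LinearMap.comp_apply, hr, hS.foldR_rT h h2]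
  rfl

/-- By `eq_zero_of_ΔB` it is enough to apply `Δ_B(p)`. The difference is then linear in `p ⊗ a`,
vanishes on representatives of values of `_λT`, and so vanishes because `_λT` is surjective. -/
theorem IsInvertibleAntipode.twistR_ΔC (a : A) (w : D.RT) :
    hS.twistR h (D.ΔC a w) = D.ΔB (S a) (hS.twistR h w) := by
  have hb := h.isMultiplierBialgebroid
  refine LinearMap.congr_fun (f := hS.twistR h ∘ₗ D.ΔC a) (g := D.ΔB (S a) ∘ₗ hS.twistR h)
    (BaseData.RT_hom_ext fun u v => sub_eq_zero.1 (hS.eq_zero_of_ΔB h _ fun p => ?_)) w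
  let N : A ⊗[ℂ] A →ₗ[ℂ] D.LT :=
    TensorProduct.lift (LinearMap.mk₂ ℂ (fun p q => D.ΔB p
        (hS.twistR h (D.ΔC q (D.relR.mkQ (u ⊗ₜ[ℂ] v)))))
        (by intros; simp only [map_add, LinearMap.add_apply])
        (by intros; simp only [map_smul, LinearMap.smul_apply])
        (by intros; simp only [map_add, LinearMap.add_apply])
        (by intros; simp only [map_smul, LinearMap.smul_apply])) -
      D.ΔB.flip (D.relL.mkQ (S v ⊗ₜ[ℂ] S u)) ∘ₗ hS.foldR ∘ₗ D.relR.mkQ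
  have hN : ∀ (a b : A) (l : A ⊗[ℂ] A), D.relR.mkQ l = D.lT (b ⊗ₜ[ℂ] a) → N l = 0 :=
    fun a b l hl => sub_eq_zero.2 (hS.ΔB_twistR_of_lT h u v a b hl)
  -- Balancing relations are representatives of `_λT(0 ⊗ 0) = 0`, so the vanishing already
  -- established shows that `N` descends to the quotient.
  have hker : D.relR ≤ LinearMap.ker N := fun l hl => hN 0 0 l (by
    rw [TensorProduct.zero_tmul, map_zero]
    exact (Submodule.Quotient.mk_eq_zero _).2 hl)
  have hzero : D.relR.liftQ N hker ∘ₗ D.lT = 0 := TensorProduct.ext' fun b a => by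
    obtain ⟨l, hl⟩ := D.relR.mkQ_surjective (D.lT (b ⊗ₜ[ℂ] a))
    rw [LinearMap.comp_apply, ← hl]
    exact hN a b l hl
  obtain ⟨hle, hbij⟩ := h.bijective_lT
  obtain ⟨t, ht⟩ := hbij.2 (D.relR.mkQ (p ⊗ₜ[ℂ] a))
  obtain ⟨t, rfl⟩ := Submodule.mkQ_surjective _ t
  have e : N (p ⊗ₜ[ℂ] a) = 0 := by
    refine (congrArg (D.relR.liftQ N hker) ht).symm.trans ?_
    exact LinearMap.congr_fun hzero t
  rw [map_sub]
  refine Eq.trans ?_ e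
  change _ = D.ΔB p _ - D.ΔB (p * S a) _
  rw [hb.left.map_mul]
  rfl

theorem IsInvertibleAntipode.twistR_lT (u a : A) :
    hS.twistR h (D.lT (u ⊗ₜ[ℂ] a)) = D.Tr (S a ⊗ₜ[ℂ] S u) := by
  have hb := h.isMultiplierBialgebroid
  refine sub_eq_zero.1 (hb.left.nondegenerate_fst _ fun d => ?_)
  obtain ⟨d, rfl⟩ := S.surjective d
  rw [map_sub, ← hS.twistR_sndMul, ← hb.right.islT_lT, hS.twistR_ΔC, ← hb.left.isTr_Tr]
  exact sub_self _

/-- It suffices to compare images under the injective `g`. Since `g(S(y) ⊗ S(x)) = T_ρ(S(y) ⊗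
S²(x))` equals `σ(_λT(S(x) ⊗ y))`, `lT_map_eq` evaluates both images to `S(b) ⊗ S²(c)`. -/
theorem IsInvertibleAntipode.twistL_Tl (c b : A) :
    hS.twistL h (D.Tl (c ⊗ₜ[ℂ] b)) = D.rT (S b ⊗ₜ[ℂ] S c) := by
  obtain ⟨l, hl⟩ := D.relL.mkQ_surjective (D.Tl (c ⊗ₜ[ℂ] b))
  refine hS.galois_injective h ?_
  rw [hS.galois_rT, ← hl]
  have e : hS.galois h ∘ₗ hS.twistL h ∘ₗ D.relL.mkQ =
      hS.twistR h ∘ₗ D.lT ∘ₗ TensorProduct.map S.toLinearMap LinearMap.id :=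
    TensorProduct.ext' fun x y => (hS.twistR_lT h (S x) y).symm
  refine (LinearMap.congr_fun e l).trans ?_
  exact congrArg (hS.twistR h) (hS.lT_map_eq h hl)

theorem IsInvertibleAntipode.twistL_ΔB (a : A) (w : D.LT) :
    hS.twistL h (D.ΔB a w) = D.ΔC (S a) (hS.twistL h w) := by
  have hb := h.isMultiplierBialgebroid
  refine LinearMap.congr_fun (f := hS.twistL h ∘ₗ D.ΔB a) (g := D.ΔC (S a) ∘ₗ hS.twistL h)
    (BaseData.LT_hom_ext fun c d => ?_) w
  change hS.twistL h (D.ΔB a (D.relL.mkQ (c ⊗ₜ[ℂ] d))) = D.ΔC (S a) (D.relR.mkQ (S d ⊗ₜ[ℂ] S c))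
  rw [hb.left.isTl_Tl, hS.twistL_mulSnd, hS.twistL_Tl, hb.right.isrT_rT]

end MultiplierBialgebroidData

end AntipodeIdentities

/-! ### Uniqueness of counits and the isomorphism onto the bi-opposite. -/

section AntipodeIso

variable {A : Type*} [NonUnitalRing A] [Module ℂ A] [IsScalarTower ℂ A A] [SMulCommClass ℂ A A]

open Multiplier MulOpposite

namespace BaseData

variable {D : BaseData A}

/-- Stated for any `T` with the right underlying multiplier, so that it applies to images under
`Multiplier.congr` whatever their membership proof. -/
theorem biopposite_SB {T : D.biopposite.B} {y : D.C} (hT : T.1 = toOp y.1) :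
    (D.biopposite.SB T).1 = toOp (D.SC y).1 := by
  obtain rfl : T = (opSubalgebraEquiv D.C).symm y := Subtype.ext hT
  rfl

theorem biopposite_SC {T : D.biopposite.C} {x : D.B} (hT : T.1 = toOp x.1) :
    (D.biopposite.SC T).1 = toOp (D.SB x).1 := by
  obtain rfl : T = (opSubalgebraEquiv D.B).symm x := Subtype.ext hT
  rfl

end BaseData

namespace MultiplierBialgebroidData

variable {D : MultiplierBialgebroidData A} {S : A ≃ₗ[ℂ] A}

/-- Surjectivity of `T_ρ` makes the two slice maps equal on all `a ⊗ d`, that is, `S_B(ε(a))d =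
S_B(φ(a))d`, and the action of `B` through `S_B` is faithful. -/
theorem IsLeftCounit.unique_of_slice_fst (h : D.IsRegularMultiplierHopfAlgebroid)
    {ε : A →ₗ[ℂ] D.B} (hε : D.IsLeftCounit ε) (φ : A →ₗ[ℂ] D.B)
    (hφ : ∀ (x : D.B) (a : A), φ (lm x.1 a) = x * φ a)
    (hs : ∀ a b, D.leftSliceFst φ hφ (D.Tr (a ⊗ₜ[ℂ] b)) = a * b) (a : A) : ε a = φ a := by
  have e : D.leftSliceFst ε hε.map_left ∘ₗ D.Tr = D.leftSliceFst φ hφ ∘ₗ D.Tr :=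
    TensorProduct.ext' fun a b => (hε.slice_fst a b).trans (hs a b).symm
  refine sub_eq_zero.1 (h.isMultiplierBialgebroid.left.faithful_right _ fun d => ?_)
  obtain ⟨t, ht⟩ := h.bijective_Tr.choose_spec.2 (D.relL.mkQ (a ⊗ₜ[ℂ] d))
  obtain ⟨t, rfl⟩ := Submodule.mkQ_surjective _ t
  have e' := LinearMap.congr_fun e t
  replace ht : D.Tr t = D.relL.mkQ (a ⊗ₜ[ℂ] d) := ht
  rw [LinearMap.comp_apply, LinearMap.comp_apply, ht] at e'
  rw [map_sub]
  exact sub_eq_zero.2 e'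

theorem IsRightCounit.unique_of_slice_fst (h : D.IsRegularMultiplierHopfAlgebroid)
    {ε : A →ₗ[ℂ] D.C} (hε : D.IsRightCounit ε) (φ : A →ₗ[ℂ] D.C)
    (hφ : ∀ (y : D.C) (a : A), φ (rm (D.SC y).1 a) = y * φ a)
    (hs : ∀ a b, D.rightSliceFst φ hφ (D.rT (a ⊗ₜ[ℂ] b)) = b * a) (a : A) : ε a = φ a := by
  have e : D.rightSliceFst ε hε.map_left ∘ₗ D.rT = D.rightSliceFst φ hφ ∘ₗ D.rT :=
    TensorProduct.ext' fun a b => (hε.slice_fst a b).trans (hs a b).symm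
  refine sub_eq_zero.1 (h.isMultiplierBialgebroid.right.faithful_right _ fun d => ?_)
  obtain ⟨t, ht⟩ := h.bijective_rT.choose_spec.2 (D.relR.mkQ (a ⊗ₜ[ℂ] d))
  obtain ⟨t, rfl⟩ := Submodule.mkQ_surjective _ t
  have e' := LinearMap.congr_fun e t
  replace ht : D.rT t = D.relR.mkQ (a ⊗ₜ[ℂ] d) := ht
  rw [LinearMap.comp_apply, LinearMap.comp_apply, ht] at e'
  exact sub_eq_zero.2 e'

variable (h : D.IsRegularMultiplierHopfAlgebroid) (hS : D.IsInvertibleAntipode S)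

include h hS

/-- The candidate `S_C ∘ ε_C ∘ S⁻¹` satisfies the first slice identity of a left counit: `twistR_lT`
rewrites `T_ρ(S(p) ⊗ S(q))` through `_λT(q ⊗ p)`, where the slice becomes `S` applied to the second
slice of `ε_C`, namely `S(qp) = S(p)S(q)`. -/
theorem IsInvertibleAntipode.leftCounit_comp {εB : A →ₗ[ℂ] D.B} {εC : A →ₗ[ℂ] D.C}
    (hB : D.IsLeftCounit εB) (hC : D.IsRightCounit εC) (a : A) :
    D.SC (εC a) = εB (S a) := by
  have hb := h.isMultiplierBialgebroid
  have hφ : ∀ (x : D.B) (a : A), D.SC (εC (S.symm (lm x.1 a))) = x * D.SC (εC (S.symm a)) := by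
    intro x a
    have e : S.symm (lm x.1 a) = rm (D.SC.symm x).1 (S.symm a) := by
      refine S.injective ?_
      rw [hS.map_rm_C hb]
      simp
    rw [e, hC.map_right, D.SC_mul, LinearEquiv.apply_symm_apply]
  refine (Eq.trans (hB.unique_of_slice_fst h (D.SC.toLinearMap ∘ₗ εC ∘ₗ S.symm.toLinearMap) hφ
    (fun p q => ?_) (S a)) (by simp)).symm
  obtain ⟨p, rfl⟩ := S.surjective p
  obtain ⟨q, rfl⟩ := S.surjective q
  rw [← hS.twistR_lT h, ← hS.map_mul, ← hC.slice_snd q p]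
  refine LinearMap.congr_fun (f := D.leftSliceFst _ hφ ∘ₗ hS.twistR h)
    (g := S.toLinearMap ∘ₗ D.rightSliceSnd εC hC.map_right)
    (BaseData.RT_hom_ext fun u v => ?_) (D.lT (q ⊗ₜ[ℂ] p))
  change lm (D.SB (D.SC (εC (S.symm (S v))))).1 (S u) = S (rm (D.SC (εC v)).1 u)
  rw [hS.map_rm_B hb, LinearEquiv.symm_apply_apply]

theorem IsInvertibleAntipode.rightCounit_comp {εB : A →ₗ[ℂ] D.B} {εC : A →ₗ[ℂ] D.C}
    (hB : D.IsLeftCounit εB) (hC : D.IsRightCounit εC) (a : A) :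
    D.SB (εB a) = εC (S a) := by
  have hb := h.isMultiplierBialgebroid
  have hφ : ∀ (y : D.C) (a : A), D.SB (εB (S.symm (rm (D.SC y).1 a))) =
      y * D.SB (εB (S.symm a)) := by
    intro y a
    have e : S.symm (rm (D.SC y).1 a) = lm (D.SB (D.SB.symm y)).1 (S.symm a) := by
      refine S.injective ?_
      rw [hS.map_lm_C hb]
      simp
    rw [e, hB.map_right, D.SB_mul, LinearEquiv.apply_symm_apply]
  refine (Eq.trans (hC.unique_of_slice_fst h (D.SB.toLinearMap ∘ₗ εB ∘ₗ S.symm.toLinearMap) hφ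
    (fun p q => ?_) (S a)) (by simp)).symm
  obtain ⟨p, rfl⟩ := S.surjective p
  obtain ⟨q, rfl⟩ := S.surjective q
  rw [← hS.twistL_Tl h, ← hS.map_mul, ← hB.slice_snd q p]
  refine LinearMap.congr_fun (f := D.rightSliceFst _ hφ ∘ₗ hS.twistL h)
    (g := S.toLinearMap ∘ₗ D.leftSliceSnd εB hB.map_right)
    (BaseData.LT_hom_ext fun u v => ?_) (D.Tl (q ⊗ₜ[ℂ] p))
  change rm (D.SB (εB (S.symm (S v)))).1 (S u) = S (lm (εB v).1 u)
  rw [hS.map_lm_B hb, LinearEquiv.symm_apply_apply]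

omit h in
theorem IsInvertibleAntipode.opEquiv_mul (a b : A) : (S ≪≫ₗ opLinearEquiv ℂ) (a * b) =
    (S ≪≫ₗ opLinearEquiv ℂ) a * (S ≪≫ₗ opLinearEquiv ℂ) b :=
  congrArg op (hS.map_mul a b)

theorem IsInvertibleAntipode.congr_B (x : D.B) :
    Multiplier.congr (S ≪≫ₗ opLinearEquiv ℂ) hS.opEquiv_mul x.1 = toOp (D.SB x).1 := by
  have hb := h.isMultiplierBialgebroid
  refine ext_lm_rm (LinearMap.ext fun a => ?_) (LinearMap.ext fun a => ?_)
  · obtain ⟨a, rfl⟩ := (S ≪≫ₗ opLinearEquiv ℂ).surjective a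
    exact (congr_lm _ _ _ a).trans (congrArg op (hS.map_lm_B hb x a))
  · obtain ⟨a, rfl⟩ := (S ≪≫ₗ opLinearEquiv ℂ).surjective a
    exact (congr_rm _ _ _ a).trans (congrArg op (hS.map_rm_B hb x a))

theorem IsInvertibleAntipode.congr_C (y : D.C) :
    Multiplier.congr (S ≪≫ₗ opLinearEquiv ℂ) hS.opEquiv_mul y.1 = toOp (D.SC y).1 := by
  have hb := h.isMultiplierBialgebroid
  refine ext_lm_rm (LinearMap.ext fun a => ?_) (LinearMap.ext fun a => ?_)
  · obtain ⟨a, rfl⟩ := (S ≪≫ₗ opLinearEquiv ℂ).surjective a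
    exact (congr_lm _ _ _ a).trans (congrArg op (hS.map_lm_C hb y a))
  · obtain ⟨a, rfl⟩ := (S ≪≫ₗ opLinearEquiv ℂ).surjective a
    exact (congr_rm _ _ _ a).trans (congrArg op (hS.map_rm_C hb y a))

/-- The antipode as an isomorphism from the base onto the base of the bi-opposite. -/
def IsInvertibleAntipode.baseIso : BaseIso D.toBaseData D.biopposite.toBaseData where
  toLinearEquiv := S ≪≫ₗ opLinearEquiv ℂ
  map_mul := hS.opEquiv_mul
  map_B := by
    refine Set.Subset.antisymm ?_ fun T hT => ?_
    · rintro _ ⟨x, hx, rfl⟩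
      rw [hS.congr_B h ⟨x, hx⟩]
      exact (D.SB ⟨x, hx⟩).2
    · obtain ⟨x, hx⟩ := D.SB.surjective ⟨toOp.symm T, hT⟩
      exact ⟨x.1, x.2, by rw [hS.congr_B h x, hx]; rfl⟩
  map_C := by
    refine Set.Subset.antisymm ?_ fun T hT => ?_
    · rintro _ ⟨y, hy, rfl⟩
      rw [hS.congr_C h ⟨y, hy⟩]
      exact (D.SC ⟨y, hy⟩).2
    · obtain ⟨y, hy⟩ := D.SC.surjective ⟨toOp.symm T, hT⟩
      exact ⟨y.1, y.2, by rw [hS.congr_C h y, hy]; rfl⟩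
  map_SB x := (hS.congr_C h (D.SB x)).trans (BaseData.biopposite_SB (hS.congr_B h x)).symm
  map_SC y := (hS.congr_B h (D.SC y)).trans (BaseData.biopposite_SC (hS.congr_C h y)).symm

/-- Reduces compatibility of the isomorphism with `Δ_B` to `twistL_ΔB`, by undoing the flip built
into the bi-opposite. -/
theorem IsInvertibleAntipode.bioppositeLT_mapLT (w : D.LT) :
    D.bioppositeLT ((hS.baseIso h).mapLT w) = hS.twistL h w :=
  LinearMap.congr_fun (f := D.bioppositeLT.toLinearMap ∘ₗ (hS.baseIso h).mapLT)
    (g := hS.twistL h) (BaseData.LT_hom_ext fun _ _ => rfl) w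

theorem IsInvertibleAntipode.bioppositeRT_mapRT (w : D.RT) :
    D.bioppositeRT ((hS.baseIso h).mapRT w) = hS.twistR h w :=
  LinearMap.congr_fun (f := D.bioppositeRT.toLinearMap ∘ₗ (hS.baseIso h).mapRT)
    (g := hS.twistR h) (BaseData.RT_hom_ext fun _ _ => rfl) w

/-- The antipode as an isomorphism onto the bi-opposite. -/
def IsInvertibleAntipode.iso : MultiplierBialgebroidIso D D.biopposite where
  toBaseIso := hS.baseIso h
  map_ΔB a w := D.bioppositeLT.injective <|
    (hS.bioppositeLT_mapLT h _).trans <| (hS.twistL_ΔB h a w).trans <|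
      (congrArg (D.ΔC (S a)) (hS.bioppositeLT_mapLT h w).symm).trans (bioppositeLT_ΔB _ _).symm
  map_ΔC a w := D.bioppositeRT.injective <|
    (hS.bioppositeRT_mapRT h _).trans <| (hS.twistR_ΔC h a w).trans <|
      (congrArg (D.ΔB (S a)) (hS.bioppositeRT_mapRT h w).symm).trans (bioppositeRT_ΔC _ _).symm

end MultiplierBialgebroidData

end AntipodeIso

theorem mainTheorem5 {A : Type*} [NonUnitalRing A] [Module ℂ A] [IsScalarTower ℂ A A]
    [SMulCommClass ℂ A A] (𝒜 : MultiplierBialgebroidData A)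
    (h𝒜 : 𝒜.IsRegularMultiplierHopfAlgebroid)
    (S : A ≃ₗ[ℂ] A) (hS : 𝒜.IsInvertibleAntipode S) :
    𝒜.biopposite.IsMultiplierBialgebroid ∧
    (∃ Φ : MultiplierBialgebroidIso 𝒜 𝒜.biopposite,
      ∀ a, Φ.toLinearEquiv a = MulOpposite.op (S a)) ∧
    (∀ (εB : A →ₗ[ℂ] 𝒜.B) (εC : A →ₗ[ℂ] 𝒜.C), 𝒜.IsLeftCounit εB → 𝒜.IsRightCounit εC →
      (∀ a, 𝒜.SB (εB a) = εC (S a)) ∧ (∀ a, 𝒜.SC (εC a) = εB (S a))) :=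
  ⟨h𝒜.isMultiplierBialgebroid.biopposite, ⟨hS.iso h𝒜, fun _ => rfl⟩, fun _ _ hB hC =>
    ⟨hS.rightCounit_comp h𝒜 hB hC, hS.leftCounit_comp h𝒜 hB hC⟩⟩
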